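/- Let $\mathbb X,\mathbb Y$ be countable alphabets with discrete $\sigma$-algebras, let $f:\mathbb X\to\mathbb Y^*$ map letters to finite (possibly empty) strings, and let $|w|$ denote the length of a string $w$. Let $T$ denote the shift $(Tx)_i=x_{i+1}$ on two-sided sequences. For $x\in\mathbb X^{\mathbb Z}$ put $$f^{\mathbb Z}(x)=\ldots f(x_{-1})f(x_0)\,.\,f(x_1)f(x_2)\ldots,$$ where the dot separates positions $0$ and $1$; either half of $f^{\mathbb Z}(x)$ may turn out to be finite, in which case $T^kf^{\mathbb Z}(x)$ belongs to no $A\subseteq\mathbb Y^{\mathbb Z}$. For measurable $A\subseteq \mathbb Y^{\mathbb Z}$ and $k\ge 0$ put $$F(A,k,x)=\mathbf 1\{T^kf^{\mathbb Z}(x)\in A\},\qquad G(A,x)=\sum_{k=0}^{|f(x_1)|-1}F(A,k,x).$$ Let $\mu$ be a probability measure on $\mathbb X^{\mathbb Z}$ that is asymptotically mean stationary (AMS), i.e. $\bar\mu(A)=\lim_{n\to\infty}\frac1n\sum_{i=0}^{n-1}\mu(T^{-i}A)$ exists for every measurable $A$. Then $\bar\mu$ (the stationary mean of $\mu$) is a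 $T$-invariant probability measure. Let $\bar l(x)=\lim_{n\to\infty}\frac1n\sum_{i=1}^n|f(x_i)|$ be the expansion rate (put $\bar l(x)=\limsup_{n\to\infty}\frac1n\sum_{i=1}^n|f(x_i)|$ where the limit does not exist), and suppose that the expected expansion rate $L=\int\bar l\,d\mu$ lies in $(0,\infty)$. Then the limit defining $\bar l$ exists $\mu$-a.e. and $\bar\mu$-a.e., $L=\int\bar l\,d\bar\mu=\int|f(x_1)|\,d\bar\mu(x)$, and the following holds. 1. The formula $$\rho(A)=\frac1L\int G(A,x)\,d\bar\mu(x),\qquad A\subseteq\mathbb Y^{\mathbb Z}\text{ measurable},$$ defines a $T$-invariant probability measure $\rho$ on $\mathbb Y^{\mathbb Z}$. 2. The measure $\rho$ is obtained by averaging over a random shift within the first codeword: $d\bar P(x)=\frac{|f(x_1)|}{L}\,d\bar\mu(x)$ defines a probability measure $\bar P$, and for every measurable $A$ $$\rho(A)=\int\frac1{|f(x_1)|}\sum_{k=0}^{|f(x_1)|-1}F(A,k,x)\,d\bar P(x),$$ i.e. $\rho$ is the law of $T^Nf^{\mathbb Z}(\bar X)$, where $\bar X$ has law $\bar P$ and,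 given $\bar X$, the shift $N$ is uniform on $\{0,\ldots,|f(\bar X_1)|-1\}$. 3. If moreover $\bar l=L$ $\mu$-a.e., then $\nu=\mu\circ(f^{\mathbb Z})^{-1}$ is an AMS probability measure on $\mathbb Y^{\mathbb Z}$ and its stationary mean is $\bar\nu=\rho$, i.e. $\lim_{n\to\infty}\frac1n\sum_{i=0}^{n-1}\nu(T^{-i}A)=\rho(A)$ for every measurable $A\subseteq\mathbb Y^{\mathbb Z}$. -/

import Mathlib

open Filter Topology MeasureTheory ProbabilityTheory
open scoped ENNReal

noncomputable section

namespace VLC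

/-- The shift `(T x)_i = x_{i+1}` on two-sided sequences. -/
def shift {α : Type*} (x : ℤ → α) : ℤ → α := fun i => x (i + 1)

/-- Cesàro averages `n⁻¹ ∑_{i<n} μ (T^{-i} A)`. -/
def cesaro {α : Type*} [MeasurableSpace α] (μ : Measure (ℤ → α)) (A : Set (ℤ → α)) (n : ℕ) :
    ℝ≥0∞ :=
  (∑ i ∈ Finset.range n, μ (shift^[i] ⁻¹' A)) / n

/-- `μ` is asymptotically mean stationary: the limits of the Cesàro averages exist for all
measurable sets. -/
def IsAMS {α : Type*} [MeasurableSpace α] (μ : Measure (ℤ → α)) : Prop :=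
  ∀ A, MeasurableSet A → ∃ a : ℝ≥0∞, Tendsto (cesaro μ A) atTop (𝓝 a)

/-- The measure `m` is the stationary mean of `μ`: its value on each measurable set is the limit
of the Cesàro averages of `μ`. -/
def IsStationaryMean {α : Type*} [MeasurableSpace α] (μ m : Measure (ℤ → α)) : Prop :=
  ∀ A, MeasurableSet A → Tendsto (cesaro μ A) atTop (𝓝 (m A))

/-- The `j`-th letter (`j = 0, 1, …`) of the infinite concatenation `w 0 ++ w 1 ++ w 2 ++ ⋯`, and
`none` if the concatenation is a finite string of length at most `j`. The letter is read off the
shortest finite concatenation `w 0 ++ ⋯ ++ w (n - 1)` that is longer than `j`; if there is no such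
`n`, then the infimum is `0` and the list is empty. -/
def letter {β : Type*} (w : ℕ → List β) (j : ℕ) : Option β :=
  ((List.range (sInf {n | j < ((List.range n).flatMap w).length})).flatMap w)[j]?

/-- The extension `f^ℤ(x) = … f(x_{-1}) f(x_0) . f(x_1) f(x_2) …`, where the dot stands between the
positions `0` and `1`. Each half of the result may be a finite string or an infinite sequence;
positions beyond the end of a finite half hold the value `none`. The left half is read from right
to left, starting at position `0`. -/
def extZ {X Y : Type*} (f : X → List Y) (x : ℤ → X) : ℤ → Option Y := fun j =>
  if 1 ≤ j then letter (fun i : ℕ => f (x ((i : ℤ) + 1))) (j - 1).toNat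
  else letter (fun i : ℕ => (f (x (-(i : ℤ)))).reverse) (-j).toNat

/-- The inclusion of the genuine two-sided sequences over `Y` into the range of `extZ`. -/
def toOpt {Y : Type*} (y : ℤ → Y) : ℤ → Option Y := fun j => some (y j)

/-- `F(A, k, x)` is `1` if `T^k (f^ℤ(x))` is a two-sided sequence that belongs to `A`, and is `0`
otherwise. -/
def F {X Y : Type*} (f : X → List Y) (A : Set (ℤ → Y)) (k : ℕ) (x : ℤ → X) : ℝ≥0∞ :=
  Set.indicator {x' : ℤ → X | shift^[k] (extZ f x') ∈ toOpt '' A} 1 x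

/-- `G(A, x) = ∑_{k < |f(x_1)|} F(A, k, x)`. -/
def G {X Y : Type*} (f : X → List Y) (A : Set (ℤ → Y)) (x : ℤ → X) : ℝ≥0∞ :=
  ∑ k ∈ Finset.range (f (x 1)).length, F f A k x

/-- `S(x, n) = ∑_{i=1}^n |f(x_i)|`. -/
def S {X Y : Type*} (f : X → List Y) (x : ℤ → X) (n : ℕ) : ℕ :=
  ∑ i ∈ Finset.Icc 1 n, (f (x (i : ℤ))).length

/-- The expansion rate, i.e. the limit of `S(x, n) / n`. The upper limit is used to have a value
for every `x`; it is the limit wherever the limit exists. -/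
def rate {X Y : Type*} (f : X → List Y) (x : ℤ → X) : ℝ≥0∞ :=
  limsup (fun n : ℕ => (S f x n : ℝ≥0∞) / (n : ℝ≥0∞)) atTop

/-- The expected expansion rate. -/
def expectedRate {X Y : Type*} [MeasurableSpace X] (f : X → List Y) (μ : Measure (ℤ → X)) : ℝ≥0∞ :=
  ∫⁻ x, rate f x ∂μ

/-- The law with density `|f(x_1)| / L` with respect to `m`. -/
def sizeBiased {X Y : Type*} [MeasurableSpace X] (f : X → List Y) (L : ℝ≥0∞)
    (m : Measure (ℤ → X)) : Measure (ℤ → X) :=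
  m.withDensity fun x => ((f (x 1)).length : ℝ≥0∞) / L

/-- `ν = μ ∘ (f^ℤ)⁻¹` as a set function on the measurable sets of two-sided sequences. -/
def IsCodedMeasure {X Y : Type*} [MeasurableSpace X] [MeasurableSpace Y] (f : X → List Y)
    (μ : Measure (ℤ → X)) (ν : Measure (ℤ → Y)) : Prop :=
  ∀ A, MeasurableSet A → ν A = μ (extZ f ⁻¹' (toOpt '' A))

end VLC

end

/-! Moving the source by one letter moves the code by one whole codeword (`extZ_shift`). So the
Birkhoff sum of `G` over n source letters counts the visits of the code to A during its first
|f(x_1)|+⋯+|f(x_n)| positions (`birkhoffSum_G`), and ρ is a mean number of visits per codeword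
divided by a mean codeword length. Replacing A by T⁻¹A changes `G` by a coboundary
(`G_preimage_shift`), hence ρ is invariant. By Poincaré recurrence in both directions, a nonempty
codeword almost surely lies in a code that is infinite on both sides, so `G` of the whole space is
|f(x_1)| and ρ has mass 1. Part 2 holds because the density |f(x_1)| cancels the weight 1/|f(x_1)|
of the uniform shift.

The stationary mean is a measure because setwise limits of probability measures are countably
additive (`exists_setwise_limit`). It agrees with μ on invariant sets, so almost sure invariant
properties and integrals of invariant functions pass between μ and μbar. In particular L is also the
integral of the rate under μbar; its finiteness forces |f(x_1)| to be integrable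
(`lintegral_le_lintegral_limsup_eAverage`), and Birkhoff's theorem then applies to |f(x_1)| and to
`G`.

For part 3, divide the Birkhoff limit of `G` by the constant limit L of S(x, n)/n. A change of time
turns averages over whole codewords into averages over all positions of the code, and dominated
convergence gives the Cesàro limits of ν. -/

namespace VLC

/-! ### Setwise limits of probability measures (Nikodym's convergence theorem) -/

section SetwiseLimit

variable {Ω : Type*} [MeasurableSpace Ω]

/-- If a sequence of probability measures converges on every measurable set, then the limit is
continuous at the empty set. -/
theorem tendsto_zero_of_setwise_limit (P : ℕ → Measure Ω) [∀ n, IsProbabilityMeasure (P n)]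
    (l : Set Ω → ℝ)
    (hl : ∀ A, MeasurableSet A → Tendsto (fun n => (P n).real A) atTop (𝓝 (l A)))
    (A : ℕ → Set Ω) (hA : ∀ k, MeasurableSet (A k)) (hanti : Antitone A)
    (hempty : ⋂ k, A k = ∅) : Tendsto (fun k => l (A k)) atTop (𝓝 0) := by
  have hlanti : Antitone fun k => l (A k) := fun i j hij =>
    le_of_tendsto_of_tendsto' (hl _ (hA j)) (hl _ (hA i)) fun n => measureReal_mono (hanti hij)
  have hl0 : ∀ k, 0 ≤ l (A k) := fun k => ge_of_tendsto' (hl _ (hA k)) fun n => measureReal_nonneg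
  have hbdd : BddBelow (Set.range fun k => l (A k)) := ⟨0, by rintro _ ⟨k, rfl⟩; exact hl0 k⟩
  have hlim := tendsto_atTop_ciInf hlanti hbdd
  set δ := ⨅ k, l (A k) with hδ
  have hδ0 : 0 ≤ δ := le_ciInf hl0
  rcases hδ0.eq_or_lt with h0 | hpos
  · rwa [← h0] at hlim
  exfalso
  have hδle : ∀ k, δ ≤ l (A k) := fun k => ciInf_le hbdd k
  have hε : 0 < δ / 10 := by positivity
  set ε := δ / 10 with hεdef
  obtain ⟨K₀, hK₀⟩ := (hlim.eventually (gt_mem_nhds (show δ < δ + ε by linarith))).exists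
  obtain ⟨N₀, hN₀⟩ := eventually_atTop.1
    ((hl _ (hA K₀)).eventually (gt_mem_nhds (show l (A K₀) < δ + 2 * ε by linarith)))
  -- Gliding hump: a late measure gives `A K` mass above δ - ε, and by its own continuity it leaves
  -- less than ε on some later `A k`. Iterating yields disjoint layers `D' j`, each with mass above
  -- δ - 2ε under its own measure.
  have step : ∀ K N : ℕ, ∃ n k, N < n ∧ K < k ∧ δ - 2 * ε < (P n).real (A K \ A k) := by
    intro K N
    obtain ⟨n, hn, hNn⟩ := (((hl _ (hA K)).eventually (lt_mem_nhds
      (show δ - ε < l (A K) by linarith [hδle K]))).and (eventually_gt_atTop N)).exists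
    have h2 : Tendsto (fun k => (P n).real (A k)) atTop (𝓝 0) := by
      have := tendsto_measure_iInter_atTop (μ := P n) (fun k => (hA k).nullMeasurableSet) hanti
        ⟨0, measure_ne_top _ _⟩
      rw [hempty, measure_empty] at this
      simpa [Measure.real, Function.comp_def] using
        (ENNReal.tendsto_toReal ENNReal.zero_ne_top).comp this
    obtain ⟨k, hk, hKk⟩ := ((h2.eventually (gt_mem_nhds hε)).and (eventually_gt_atTop K)).exists
    refine ⟨n, k, hNn, hKk, ?_⟩
    rw [measureReal_sdiff (hanti hKk.le) (hA k)]
    linarith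
  choose nn kk hnn hkk hnk using step
  let s : ℕ → ℕ × ℕ := fun j =>
    Nat.rec (K₀, N₀) (fun _ p => (kk p.1 p.2, nn p.1 p.2)) j
  have hs : ∀ j, s (j + 1) = (kk (s j).1 (s j).2, nn (s j).1 (s j).2) := fun j => rfl
  have hk1 : StrictMono fun j => (s j).1 := strictMono_nat_of_lt_succ fun j => by
    rw [hs]; exact hkk _ _
  have hn1 : StrictMono fun j => (s j).2 := strictMono_nat_of_lt_succ fun j => by
    rw [hs]; exact hnn _ _
  set D' : ℕ → Set Ω := fun j => A (s j).1 \ A (s (j + 1)).1 with hD'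
  have hD'm : ∀ j, MeasurableSet (D' j) := fun j => (hA _).diff (hA _)
  have hbig : ∀ j, δ - 2 * ε < (P (s (j + 1)).2).real (D' j) := fun j => hnk _ _
  have hdisj : ∀ i j, i < j → Disjoint (D' i) (D' j) := fun i j hij =>
    Set.disjoint_left.2 fun x hx hx' => hx.2 (hanti (hk1.monotone (Nat.succ_le_of_lt hij)) hx'.1)
  have hsub : ∀ j, D' j ⊆ A K₀ := fun j x hx => hanti (hk1.monotone (Nat.zero_le j)) hx.1
  -- Only every other layer is kept. The measures of the even layers force l D ≥ δ - 2ε = 8ε. The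
  -- measures of the odd layers spend δ - 2ε outside D out of at most δ + 2ε on `A K₀`, which forces
  -- l D ≤ 4ε.
  set D := ⋃ j, D' (2 * j) with hD
  have hDm : MeasurableSet D := .iUnion fun j => hD'm _
  have hlow : δ - 2 * ε ≤ l D := by
    refine ge_of_tendsto' ((hl D hDm).comp (hn1.tendsto_atTop.comp
      (tendsto_atTop_mono (fun j : ℕ => (by omega : j ≤ 2 * j + 1)) tendsto_id))) fun j => ?_
    exact (hbig (2 * j)).le.trans (measureReal_mono (Set.subset_iUnion (fun j => D' (2 * j)) j))
  have hupp : l D ≤ 4 * ε := by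
    refine le_of_tendsto' ((hl D hDm).comp (hn1.tendsto_atTop.comp
      (tendsto_atTop_mono (fun j : ℕ => (by omega : j ≤ 2 * j + 1 + 1)) tendsto_id))) fun j => ?_
    have hd : Disjoint D (D' (2 * j + 1)) := by
      refine Set.disjoint_iUnion_left.2 fun i => ?_
      rcases lt_or_ge (2 * i) (2 * j + 1) with h | h
      · exact hdisj _ _ h
      · exact (hdisj (2 * j + 1) (2 * i) (by omega)).symm
    have h1 := measureReal_union (μ := P (s (2 * j + 1 + 1)).2) hd (hD'm (2 * j + 1))
    have h2 : (P (s (2 * j + 1 + 1)).2).real (D ∪ D' (2 * j + 1)) ≤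
        (P (s (2 * j + 1 + 1)).2).real (A K₀) :=
      measureReal_mono (Set.union_subset (Set.iUnion_subset fun _ => hsub _) (hsub (2 * j + 1)))
    have h3 := hN₀ (s (2 * j + 1 + 1)).2 (hn1.monotone (Nat.zero_le (2 * j + 1 + 1)))
    have h4 := hbig (2 * j + 1)
    simp only [Function.comp_apply]
    linarith
  linarith

/-- The setwise limit of a sequence of probability measures is a probability measure. -/
theorem exists_setwise_limit (P : ℕ → Measure Ω) [∀ n, IsProbabilityMeasure (P n)]
    (h : ∀ A, MeasurableSet A → ∃ a, Tendsto (fun n => P n A) atTop (𝓝 a)) :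
    ∃ m : Measure Ω, IsProbabilityMeasure m ∧
      ∀ A, MeasurableSet A → Tendsto (fun n => P n A) atTop (𝓝 (m A)) := by
  choose! l hl using h
  have hfin : ∀ A, MeasurableSet A → l A ≠ ∞ := fun A hA =>
    ((le_of_tendsto' (hl A hA) fun n => prob_le_one).trans_lt ENNReal.one_lt_top).ne
  have hlr : ∀ A, MeasurableSet A →
      Tendsto (fun n => (P n).real A) atTop (𝓝 (l A).toReal) := fun A hA =>
    (ENNReal.tendsto_toReal (hfin A hA)).comp (hl A hA)
  have hl0 : l ∅ = 0 := tendsto_nhds_unique (hl _ .empty) (by simp)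
  have hunion : ∀ A B, MeasurableSet A → MeasurableSet B → Disjoint A B →
      l (A ∪ B) = l A + l B := fun A B hA hB hd =>
    tendsto_nhds_unique (hl _ (hA.union hB)) <| by
      simpa only [measure_union hd hB] using (hl A hA).add (hl B hB)
  have hm : ∀ ⦃f : ℕ → Set Ω⦄, (∀ i, MeasurableSet (f i)) → Pairwise (Function.onFun Disjoint f) →
      l (⋃ i, f i) = ∑' i, l (f i) := by
    intro f hf hd
    -- Finite additivity splits off the first k sets; countable additivity remains as the claim that
    -- the limit vanishes along the tails `A k`.
    set A : ℕ → Set Ω := fun k => ⋃ i, f (i + k) with hAdef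
    have hA : ∀ k, MeasurableSet (A k) := fun k => .iUnion fun i => hf _
    have hsucc : ∀ k, A k = f k ∪ A (k + 1) := fun k => by
      ext x
      simp only [hAdef, Set.mem_iUnion, Set.mem_union]
      constructor
      · rintro ⟨_ | i, hi⟩
        · exact .inl (by simpa using hi)
        · exact .inr ⟨i, by rwa [show i + (k + 1) = i + 1 + k by omega]⟩
      · rintro (h | ⟨i, hi⟩)
        · exact ⟨0, by simpa using h⟩
        · exact ⟨i + 1, by rwa [show i + 1 + k = i + (k + 1) by omega]⟩
    have hdk : ∀ k, Disjoint (f k) (A (k + 1)) := fun k =>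
      Set.disjoint_iUnion_right.2 fun i => hd (by omega)
    have hanti : Antitone A := antitone_nat_of_succ_le fun k => by
      rw [hsucc k]; exact Set.subset_union_right
    have hempty : ⋂ k, A k = ∅ := by
      refine Set.eq_empty_iff_forall_notMem.2 fun x hx => ?_
      rw [Set.mem_iInter] at hx
      obtain ⟨i, hi⟩ := Set.mem_iUnion.1 (hx 0)
      obtain ⟨j, hj⟩ := Set.mem_iUnion.1 (hx (i + 1))
      exact Set.disjoint_left.1 (hd (show i + 0 ≠ j + (i + 1) by omega)) hi hj
    have ht := tendsto_zero_of_setwise_limit P (fun A => (l A).toReal) hlr A hA hanti hempty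
    have ht' : Tendsto (fun k => l (A k)) atTop (𝓝 0) := by
      rw [← ENNReal.tendsto_toReal_iff (fun k => hfin _ (hA k)) ENNReal.zero_ne_top]
      simpa using ht
    have hsum : ∀ k, l (⋃ i, f i) = ∑ i ∈ Finset.range k, l (f i) + l (A k) := by
      intro k
      induction k with
      | zero => simp [hAdef]
      | succ k ih =>
        rw [ih, hsucc k, hunion _ _ (hf k) (hA _) (hdk k), Finset.sum_range_succ, add_assoc]
    have h1 := (ENNReal.tendsto_nat_tsum fun i => l (f i)).add ht'
    rw [add_zero] at h1
    exact tendsto_nhds_unique (tendsto_const_nhds.congr hsum) h1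
  refine ⟨Measure.ofMeasurable (fun A _ => l A) hl0 hm, ⟨?_⟩, fun A hA => ?_⟩
  · rw [Measure.ofMeasurable_apply _ .univ]
    exact tendsto_nhds_unique (hl _ .univ) (by simp)
  · rw [Measure.ofMeasurable_apply _ hA]
    exact hl A hA

end SetwiseLimit

/-! ### Birkhoff averages with extended nonnegative values -/

section Averages

variable {Ω : Type*} {T : Ω → Ω}

/-- The averages `n⁻¹ ∑_{k<n} φ (T^k x)` in the extended nonnegative reals. -/
noncomputable def eAverage (T : Ω → Ω) (φ : Ω → ℝ≥0∞) (n : ℕ) (x : Ω) : ℝ≥0∞ :=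
  birkhoffSum T φ n x / n

theorem birkhoffSum_toReal {φ : Ω → ℝ≥0∞} {x : Ω} (h : ∀ k, φ (T^[k] x) ≠ ∞) (n : ℕ) :
    (birkhoffSum T φ n x).toReal = birkhoffSum T (fun x => (φ x).toReal) n x :=
  ENNReal.toReal_sum fun k _ => h k

theorem birkhoffSum_sub_const {ψ : Ω → ℝ} (b : ℝ) (n : ℕ) (x : Ω) :
    birkhoffSum T (fun x => ψ x - b) n x = birkhoffSum T ψ n x - n * b := by
  simp [birkhoffSum, Finset.sum_sub_distrib]

theorem birkhoffSum_const_sub {ψ : Ω → ℝ} (a : ℝ) (n : ℕ) (x : Ω) :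
    birkhoffSum T (fun x => a - ψ x) n x = n * a - birkhoffSum T ψ n x := by
  simp [birkhoffSum, Finset.sum_sub_distrib]

theorem eAverage_succ {φ : Ω → ℝ≥0∞} (n : ℕ) (x : Ω) :
    eAverage T φ (n + 1) x =
      φ x / (n + 1 : ℕ) + eAverage T φ n (T x) * ((n : ℝ≥0∞) / (n + 1 : ℕ)) := by
  rcases n.eq_zero_or_pos with rfl | hn
  · simp [eAverage]
  · have h0 : (n : ℝ≥0∞) ≠ 0 := by simpa using hn.ne'
    have ht : (n : ℝ≥0∞) ≠ ∞ := ENNReal.natCast_ne_top n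
    rw [eAverage, eAverage, birkhoffSum_succ', ENNReal.add_div]
    congr 1
    rw [div_eq_mul_inv, div_eq_mul_inv, div_eq_mul_inv, mul_assoc, ← mul_assoc (n : ℝ≥0∞)⁻¹,
      ENNReal.inv_mul_cancel h0 ht, one_mul]

theorem tendsto_natCast_div_succ :
    Tendsto (fun n : ℕ => (n : ℝ≥0∞) / (n + 1 : ℕ)) atTop (𝓝 1) := by
  have h := tendsto_natCast_div_add_atTop (1 : ℝ)
  have h2 := ENNReal.tendsto_ofReal h
  rw [ENNReal.ofReal_one] at h2
  refine h2.congr fun n => ?_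
  rw [ENNReal.ofReal_div_of_pos (by positivity), ENNReal.ofReal_natCast]
  norm_cast

end Averages

/-! ### The maximal ergodic theorem -/

section Ergodic

variable {Ω : Type*} [MeasurableSpace Ω] {m : Measure Ω} {T : Ω → Ω}

theorem measurable_birkhoffSum {M : Type*} [AddCommMonoid M] [MeasurableSpace M] [MeasurableAdd₂ M]
    (hT : Measurable T) {φ : Ω → M} (hφ : Measurable φ) (n : ℕ) :
    Measurable (birkhoffSum T φ n) :=
  Finset.measurable_sum _ fun k _ => hφ.comp (hT.iterate k)

theorem integrable_birkhoffSum (hT : MeasurePreserving T m m) {φ : Ω → ℝ} (hφ : Integrable φ m)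
    (n : ℕ) : Integrable (birkhoffSum T φ n) m :=
  integrable_finsetSum _ fun k _ => (hT.iterate k).integrable_comp_of_integrable hφ

/-- The maximal ergodic inequality for finitely many partial sums. -/
theorem setIntegral_maximal_nonneg (hT : MeasurePreserving T m m) {φ : Ω → ℝ}
    (hφm : Measurable φ) (hφ : Integrable φ m) (N : ℕ) :
    0 ≤ ∫ x in {x | ∃ n ≤ N, 0 < birkhoffSum T φ n x}, φ x ∂m := by
  -- Garsia's argument: `mx n` is the maximum of 0 and the first n Birkhoff sums.
  let mx : ℕ → Ω → ℝ := fun n x => Nat.rec 0 (fun k r => max r (birkhoffSum T φ (k + 1) x)) n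
  have mx0 : ∀ x, mx 0 x = 0 := fun _ => rfl
  have mxs : ∀ n x, mx (n + 1) x = max (mx n x) (birkhoffSum T φ (n + 1) x) := fun _ _ => rfl
  have hmeas : ∀ n, Measurable (mx n) := by
    intro n
    induction n with
    | zero => exact measurable_const
    | succ n ih => exact ih.max (measurable_birkhoffSum hT.measurable hφm _)
  have hint : ∀ n, Integrable (mx n) m := by
    intro n
    induction n with
    | zero => exact integrable_zero _ _ _
    | succ n ih => exact ih.sup (integrable_birkhoffSum hT hφ _)
  have hge : ∀ N n x, n ≤ N → birkhoffSum T φ n x ≤ mx N x := by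
    intro N n x hn
    induction N with
    | zero =>
      obtain rfl : n = 0 := by omega
      simp [mx0]
    | succ N ih =>
      rw [mxs]
      rcases Nat.le_succ_iff.1 hn with h | rfl
      · exact (ih h).trans (le_max_left _ _)
      · exact le_max_right _ _
  have hnn : ∀ N x, 0 ≤ mx N x := fun N x => by simpa using hge N 0 x (Nat.zero_le _)
  have hexists : ∀ N x, ∃ n ≤ N, mx N x = birkhoffSum T φ n x := by
    intro N x
    induction N with
    | zero => exact ⟨0, le_rfl, by simp [mx0]⟩
    | succ N ih =>
      obtain ⟨n, hn, h⟩ := ih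
      rw [mxs]
      rcases max_choice (mx N x) (birkhoffSum T φ (N + 1) x) with h' | h'
      · exact ⟨n, by omega, h'.trans h⟩
      · exact ⟨N + 1, le_rfl, h'⟩
  set E := {x | ∃ n ≤ N, 0 < birkhoffSum T φ n x} with hE
  have hEm : E = {x | 0 < mx N x} := by
    ext x
    constructor
    · rintro ⟨n, hn, h⟩
      exact h.trans_le (hge N n x hn)
    · intro h
      obtain ⟨n, hn, h'⟩ := hexists N x
      exact ⟨n, hn, h' ▸ h⟩
  have hEmeas : MeasurableSet E := by
    rw [hEm]; exact measurableSet_lt measurable_const (hmeas N)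
  -- On E the maximum is positive, so it is attained by a sum with at least one term; removing φ x
  -- leaves a sum started at T x. After integration the left side is nonnegative, since `mx N`
  -- vanishes off E, is nonnegative everywhere, and has the same integral as its composition with T.
  have hkey : ∀ x ∈ E, mx N x - mx N (T x) ≤ φ x := by
    intro x hx
    rw [hEm] at hx
    obtain ⟨n, hn, h⟩ := hexists N x
    rcases n with _ | n
    · simp only [birkhoffSum_zero] at h
      exact absurd h (ne_of_gt hx)
    · rw [h, birkhoffSum_succ']
      linarith [hge N n (T x) (by omega)]
  have hintT : Integrable (fun x => mx N (T x)) m := hT.integrable_comp_of_integrable (hint N)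
  have h1 : ∫ x in E, (mx N x - mx N (T x)) ∂m ≤ ∫ x in E, φ x ∂m :=
    setIntegral_mono_on ((hint N).sub hintT).integrableOn hφ.integrableOn hEmeas hkey
  have h2 : ∫ x in E, (mx N x - mx N (T x)) ∂m =
      ∫ x in E, mx N x ∂m - ∫ x in E, mx N (T x) ∂m :=
    integral_sub (hint N).integrableOn hintT.integrableOn
  have h3 : ∫ x in E, mx N x ∂m = ∫ x, mx N x ∂m := by
    refine setIntegral_eq_integral_of_forall_compl_eq_zero fun x hx => ?_
    rw [hEm] at hx
    exact le_antisymm (not_lt.1 hx) (hnn N x)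
  have h4 : ∫ x in E, mx N (T x) ∂m ≤ ∫ x, mx N (T x) ∂m :=
    setIntegral_le_integral hintT (.of_forall fun x => hnn N _)
  have h5 : ∫ x, mx N (T x) ∂m = ∫ x, mx N x ∂m := by
    conv_rhs => rw [← hT.map_eq]
    rw [integral_map hT.measurable.aemeasurable (hmeas N).aestronglyMeasurable]
  linarith

/-- The maximal ergodic theorem. -/
theorem integral_nonneg_of_ae_exists_birkhoffSum_pos (hT : MeasurePreserving T m m) {φ : Ω → ℝ}
    (hφm : Measurable φ) (hφ : Integrable φ m) (h : ∀ᵐ x ∂m, ∃ n, 0 < birkhoffSum T φ n x) :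
    0 ≤ ∫ x, φ x ∂m := by
  set E : ℕ → Set Ω := fun N => {x | ∃ n ≤ N, 0 < birkhoffSum T φ n x}
  have hE : ∀ N, MeasurableSet (E N) := fun N => by
    have : E N = ⋃ n, ⋃ (_ : n ≤ N), {x | 0 < birkhoffSum T φ n x} := by ext; simp [E]
    rw [this]
    exact .iUnion fun n => .iUnion fun _ =>
      measurableSet_lt measurable_const (measurable_birkhoffSum hT.measurable hφm _)
  have hmono : Monotone E := fun i j hij x ⟨n, hn, hx⟩ => ⟨n, hn.trans hij, hx⟩
  have ht := tendsto_setIntegral_of_monotone (μ := m) hE hmono hφ.integrableOn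
  have hu : ∫ x in ⋃ N, E N, φ x ∂m = ∫ x, φ x ∂m := by
    rw [← setIntegral_univ (μ := m)]
    refine setIntegral_congr_set ?_
    filter_upwards [h] with x ⟨n, hn⟩
    exact propext ⟨fun _ => trivial, fun _ => Set.mem_iUnion.2 ⟨n, n, le_rfl, hn⟩⟩
  rw [← hu]
  exact ge_of_tendsto' ht fun N => setIntegral_maximal_nonneg hT hφm hφ N

theorem measurable_eAverage (hT : Measurable T) {φ : Ω → ℝ≥0∞} (hφ : Measurable φ) (n : ℕ) :
    Measurable (eAverage T φ n) :=
  (measurable_birkhoffSum hT hφ n).div_const _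

theorem ae_forall_iterate (hT : MeasurePreserving T m m) {p : Ω → Prop} (h : ∀ᵐ x ∂m, p x) :
    ∀ᵐ x ∂m, ∀ k : ℕ, p (T^[k] x) :=
  ae_all_iff.2 fun k => (hT.iterate k).quasiMeasurePreserving.ae h

/-- If the averages of `φ` exceed `b` at some time almost surely, then so does its integral. -/
theorem mul_le_integral_of_ae_exists_lt [IsFiniteMeasure m] (hT : MeasurePreserving T m m)
    {ψ : Ω → ℝ} (hψm : Measurable ψ) (hψ : Integrable ψ m) (b : ℝ)
    (h : ∀ᵐ x ∂m, ∃ n : ℕ, n * b < birkhoffSum T ψ n x) : b * m.real Set.univ ≤ ∫ x, ψ x ∂m := by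
  have := integral_nonneg_of_ae_exists_birkhoffSum_pos hT (hψm.sub_const b)
    (hψ.sub (integrable_const b)) (by simpa only [birkhoffSum_sub_const, sub_pos] using h)
  rw [integral_sub hψ (integrable_const b), integral_const, smul_eq_mul] at this
  linarith

theorem integral_le_mul_of_ae_exists_lt [IsFiniteMeasure m] (hT : MeasurePreserving T m m)
    {ψ : Ω → ℝ} (hψm : Measurable ψ) (hψ : Integrable ψ m) (a : ℝ)
    (h : ∀ᵐ x ∂m, ∃ n : ℕ, birkhoffSum T ψ n x < n * a) : ∫ x, ψ x ∂m ≤ a * m.real Set.univ := by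
  have := integral_nonneg_of_ae_exists_birkhoffSum_pos hT (hψm.const_sub a)
    ((integrable_const a).sub hψ) (by simpa only [birkhoffSum_const_sub, sub_pos] using h)
  rw [integral_sub (integrable_const a) hψ, integral_const, smul_eq_mul] at this
  linarith

end Ergodic

/-! ### Upper and lower limits under asymptotically trivial factors -/

section ENNRealLimits

theorem limsup_mul_of_tendsto_one {u r : ℕ → ℝ≥0∞} (hr : Tendsto r atTop (𝓝 1)) :
    limsup (u * r) atTop = limsup u atTop := by
  refine le_antisymm ?_ ?_
  · refine (ENNReal.limsup_mul_le' ?_ ?_).trans ?_ <;> simp [hr.limsup_eq]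
  · have := ENNReal.le_limsup_mul (u := u) (v := r) (f := atTop)
    rwa [hr.liminf_eq, mul_one] at this

theorem liminf_mul_of_tendsto_one {u r : ℕ → ℝ≥0∞} (hr : Tendsto r atTop (𝓝 1)) :
    liminf (u * r) atTop = liminf u atTop := by
  refine le_antisymm ?_ ?_
  · rw [mul_comm u r]
    refine (ENNReal.liminf_mul_le ?_ ?_).trans ?_ <;> simp [hr.limsup_eq]
  · have := ENNReal.le_liminf_mul (u := u) (v := r) (f := atTop)
    rwa [hr.liminf_eq, mul_one] at this

theorem tendsto_const_div_succ {c : ℝ≥0∞} (hc : c ≠ ∞) :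
    Tendsto (fun n : ℕ => c / (n + 1 : ℕ)) atTop (𝓝 0) := by
  have h := ENNReal.Tendsto.const_div (a := c) ENNReal.tendsto_nat_nhds_top (.inr hc)
  rw [ENNReal.div_top] at h
  exact h.comp (tendsto_add_atTop_nat 1)

end ENNRealLimits

/-! ### Invariance of the upper and lower averages -/

section Averages

variable {Ω : Type*} {T : Ω → Ω} {φ : Ω → ℝ≥0∞}

/-- By `eAverage_succ` the two sequences differ by a factor tending to 1 and by φ x / (n + 1), which
tends to 0 because φ x is finite. -/
theorem limsup_eAverage_comp (hφ : ∀ x, φ x ≠ ∞) (x : Ω) :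
    limsup (fun n => eAverage T φ n (T x)) atTop = limsup (fun n => eAverage T φ n x) atTop := by
  rw [← limsup_nat_add (fun n => eAverage T φ n x) 1]
  simp only [eAverage_succ]
  rw [← limsup_mul_of_tendsto_one tendsto_natCast_div_succ]
  exact (ENNReal.limsup_add_of_left_tendsto_zero (tendsto_const_div_succ (hφ x)) _).symm

theorem liminf_eAverage_comp (hφ : ∀ x, φ x ≠ ∞) (x : Ω) :
    liminf (fun n => eAverage T φ n (T x)) atTop = liminf (fun n => eAverage T φ n x) atTop := by
  rw [← liminf_nat_add (fun n => eAverage T φ n x) 1]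
  simp only [eAverage_succ]
  rw [← liminf_mul_of_tendsto_one tendsto_natCast_div_succ]
  exact (ENNReal.liminf_add_of_left_tendsto_zero (tendsto_const_div_succ (hφ x)) _).symm

end Averages

/-! ### Birkhoff's theorem and the integral of the limit -/

section Birkhoff

variable {Ω : Type*} [MeasurableSpace Ω] {m : Measure Ω} {T : Ω → Ω} {φ : Ω → ℝ≥0∞}

/-- The set E is invariant, so the maximal theorem may be applied to the restriction of m to E. It
gives b · m(E) ≤ ∫_E φ ≤ a · m(E) with a < b. -/
theorem measure_upcrossing_eAverage_eq_zero [IsFiniteMeasure m] (hT : MeasurePreserving T m m)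
    (hφm : Measurable φ) (hφ : ∀ x, φ x ≠ ∞) (hint : ∫⁻ x, φ x ∂m ≠ ∞) {a b : NNReal}
    (hab : a < b) :
    m {x | liminf (fun n => eAverage T φ n x) atTop < a ∧
      b < limsup (fun n => eAverage T φ n x) atTop} = 0 := by
  set E := {x | liminf (fun n => eAverage T φ n x) atTop < a ∧
      b < limsup (fun n => eAverage T φ n x) atTop} with hE
  have hEm : MeasurableSet E :=
    (measurableSet_lt (.liminf fun n => measurable_eAverage hT.measurable hφm n)
      measurable_const).inter
    (measurableSet_lt measurable_const (.limsup fun n => measurable_eAverage hT.measurable hφm n))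
  have hinv : T ⁻¹' E = E := by
    ext x
    change (_ ∧ _) ↔ (_ ∧ _)
    rw [limsup_eAverage_comp hφ, liminf_eAverage_comp hφ]
  have hTE : MeasurePreserving T (m.restrict E) (m.restrict E) := by
    have := hT.restrict_preimage hEm
    rwa [hinv] at this
  have hψm : Measurable fun x => (φ x).toReal := hφm.ennreal_toReal
  have hψ : Integrable (fun x => (φ x).toReal) (m.restrict E) :=
    (integrable_toReal_of_lintegral_ne_top hφm.aemeasurable hint).restrict
  have hreal : ∀ n x, birkhoffSum T φ n x =
      ENNReal.ofReal (birkhoffSum T (fun x => (φ x).toReal) n x) := fun n x => by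
    rw [← birkhoffSum_toReal fun k => hφ _, ENNReal.ofReal_toReal]
    exact ENNReal.sum_ne_top.2 fun k _ => hφ _
  have hnn : ∀ n x, 0 ≤ birkhoffSum T (fun x => (φ x).toReal) n x := fun n x =>
    Finset.sum_nonneg fun k _ => ENNReal.toReal_nonneg
  have hcast : ∀ (n : ℕ) (c : NNReal), (c : ℝ≥0∞) * n = ENNReal.ofReal (n * c) := fun n c => by
    rw [ENNReal.ofReal_mul (by positivity), ENNReal.ofReal_natCast, ENNReal.ofReal_coe_nnreal,
      mul_comm]
  have h1 := integral_le_mul_of_ae_exists_lt hTE hψm hψ a <| by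
    refine (ae_restrict_mem hEm).mono fun x hx => ?_
    obtain ⟨n, hn, hn0⟩ := ((frequently_lt_of_liminf_lt (by isBoundedDefault) hx.1).and_eventually
      (eventually_gt_atTop 0)).exists
    refine ⟨n, ?_⟩
    rw [eAverage, ENNReal.div_lt_iff (by simp [hn0.ne']) (by simp), hcast, hreal,
      ENNReal.ofReal_lt_ofReal_iff_of_nonneg (hnn _ _)] at hn
    exact hn
  have h2 := mul_le_integral_of_ae_exists_lt hTE hψm hψ b <| by
    refine (ae_restrict_mem hEm).mono fun x hx => ?_
    obtain ⟨n, hn, hn0⟩ := ((frequently_lt_of_lt_limsup (by isBoundedDefault) hx.2).and_eventually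
      (eventually_gt_atTop 0)).exists
    refine ⟨n, ?_⟩
    rw [eAverage, ENNReal.lt_div_iff_mul_lt (by simp [hn0.ne']) (by simp), hcast, hreal,
      ENNReal.ofReal_lt_ofReal_iff_of_nonneg (by positivity)] at hn
    exact hn
  have hab' : (a : ℝ) < b := hab
  have h3 : (m.restrict E).real Set.univ = 0 := by
    have : 0 ≤ (m.restrict E).real Set.univ := measureReal_nonneg
    nlinarith
  rw [measureReal_restrict_apply_univ] at h3
  exact (measureReal_eq_zero_iff (measure_ne_top _ _)).1 h3

/-- Birkhoff's pointwise ergodic theorem: the averages of an integrable function converge. -/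
theorem ae_tendsto_eAverage [IsFiniteMeasure m] (hT : MeasurePreserving T m m)
    (hφm : Measurable φ) (hφ : ∀ x, φ x ≠ ∞) (hint : ∫⁻ x, φ x ∂m ≠ ∞) :
    ∀ᵐ x ∂m, Tendsto (fun n => eAverage T φ n x) atTop
      (𝓝 (limsup (fun n => eAverage T φ n x) atTop)) := by
  have h : ∀ᵐ x ∂m, ∀ p q : ℚ, Real.toNNReal p < Real.toNNReal q →
      ¬ (liminf (fun n => eAverage T φ n x) atTop < Real.toNNReal p ∧
        Real.toNNReal q < limsup (fun n => eAverage T φ n x) atTop) := by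
    refine ae_all_iff.2 fun p => ae_all_iff.2 fun q => ?_
    by_cases hpq : Real.toNNReal p < Real.toNNReal q
    · have h0 := measure_upcrossing_eAverage_eq_zero hT hφm hφ hint hpq
      filter_upwards [measure_eq_zero_iff_ae_notMem.1 h0] with x hx _ using hx
    · exact .of_forall fun x h => absurd h hpq
  filter_upwards [h] with x hx
  refine tendsto_of_le_liminf_of_limsup_le ?_ le_rfl
  by_contra! hlt
  obtain ⟨q, -, hq1, hq2⟩ := ENNReal.lt_iff_exists_rat_btwn.1 hlt
  obtain ⟨p, -, hp1, hp2⟩ := ENNReal.lt_iff_exists_rat_btwn.1 hq1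
  exact hx p q (by exact_mod_cast hp2) ⟨hp1, hq2⟩

theorem lintegral_eAverage (hT : MeasurePreserving T m m) (hφm : Measurable φ) {n : ℕ}
    (hn : n ≠ 0) : ∫⁻ x, eAverage T φ n x ∂m = ∫⁻ x, φ x ∂m := by
  simp only [eAverage, div_eq_mul_inv, birkhoffSum]
  have hk : ∀ k, Measurable fun x => φ (T^[k] x) := fun k => hφm.comp (hT.measurable.iterate k)
  rw [lintegral_mul_const _ (Finset.measurable_sum _ fun k _ => hk k),
    lintegral_finsetSum _ fun k _ => hk k]
  have : ∀ k, ∫⁻ x, φ (T^[k] x) ∂m = ∫⁻ x, φ x ∂m := fun k =>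
    (hT.iterate k).lintegral_comp hφm
  simp only [this, Finset.sum_const, Finset.card_range, nsmul_eq_mul]
  rw [mul_comm (n : ℝ≥0∞), mul_assoc, ENNReal.mul_inv_cancel (by simpa) (by simp), mul_one]

/-- Integrability of φ is deliberately not assumed: this is how it is deduced from a finite expected
rate. Truncations of φ at M have averages bounded by M, so dominated convergence settles them, and M
then tends to infinity. -/
theorem lintegral_le_lintegral_limsup_eAverage [IsFiniteMeasure m] (hT : MeasurePreserving T m m)
    (hφm : Measurable φ) :
    ∫⁻ x, φ x ∂m ≤ ∫⁻ x, limsup (fun n => eAverage T φ n x) atTop ∂m := by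
  have hb : ∀ M : ℕ, ∫⁻ x, min (φ x) M ∂m ≤
      ∫⁻ x, limsup (fun n => eAverage T φ n x) atTop ∂m := by
    intro M
    have hm : Measurable fun x => min (φ x) (M : ℝ≥0∞) := hφm.min measurable_const
    have hfin : ∀ x, min (φ x) (M : ℝ≥0∞) ≠ ∞ := fun x =>
      ((min_le_right _ _).trans_lt (ENNReal.natCast_lt_top M)).ne
    have hint : ∫⁻ x, min (φ x) (M : ℝ≥0∞) ∂m ≠ ∞ := by
      refine ((lintegral_mono fun x => min_le_right _ _).trans_lt ?_).ne
      rw [lintegral_const]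
      exact ENNReal.mul_lt_top (ENNReal.natCast_lt_top M) (measure_lt_top _ _)
    have hbd : ∀ n x, eAverage T (fun x => min (φ x) (M : ℝ≥0∞)) n x ≤ M := fun n x => by
      rw [eAverage]
      refine ENNReal.div_le_of_le_mul ?_
      refine (Finset.sum_le_card_nsmul _ _ _ fun k _ => min_le_right _ _).trans ?_
      simp [mul_comm]
    have ht := tendsto_lintegral_of_dominated_convergence (μ := m) (fun _ => (M : ℝ≥0∞))
      (fun n => measurable_eAverage hT.measurable hm n) (fun n => .of_forall (hbd n))
      (by simpa using ENNReal.mul_ne_top (ENNReal.natCast_ne_top M) (measure_ne_top m _))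
      (ae_tendsto_eAverage hT hm hfin hint)
    have heq := tendsto_nhds_unique ht <| tendsto_const_nhds.congr' <|
      (eventually_ne_atTop 0).mono fun n hn => (lintegral_eAverage hT hm hn).symm
    rw [← heq]
    refine lintegral_mono fun x => limsup_le_limsup (.of_forall fun n => ?_)
    exact ENNReal.div_le_div_right (Finset.sum_le_sum fun k _ => min_le_left _ _) _
  have hsup : ∀ x, φ x = ⨆ M : ℕ, min (φ x) (M : ℝ≥0∞) := fun x => by
    rw [← inf_iSup_eq, ENNReal.iSup_natCast, inf_top_eq]
  calc ∫⁻ x, φ x ∂m = ∫⁻ x, ⨆ M : ℕ, min (φ x) (M : ℝ≥0∞) ∂m := lintegral_congr hsup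
    _ = ⨆ M : ℕ, ∫⁻ x, min (φ x) (M : ℝ≥0∞) ∂m :=
      lintegral_iSup (fun M => hφm.min measurable_const) fun i j hij x =>
        min_le_min_left _ (by exact_mod_cast hij)
    _ ≤ _ := iSup_le hb

/-- The remaining inequality is Fatou's lemma, since the upper and lower limits agree almost
everywhere. -/
theorem lintegral_limsup_eAverage [IsFiniteMeasure m] (hT : MeasurePreserving T m m)
    (hφm : Measurable φ) (hφ : ∀ x, φ x ≠ ∞) (hint : ∫⁻ x, φ x ∂m ≠ ∞) :
    ∫⁻ x, limsup (fun n => eAverage T φ n x) atTop ∂m = ∫⁻ x, φ x ∂m := by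
  refine le_antisymm ?_ (lintegral_le_lintegral_limsup_eAverage hT hφm)
  calc ∫⁻ x, limsup (fun n => eAverage T φ n x) atTop ∂m
      = ∫⁻ x, liminf (fun n => eAverage T φ n x) atTop ∂m :=
        lintegral_congr_ae ((ae_tendsto_eAverage hT hφm hφ hint).mono fun x hx =>
          hx.liminf_eq.symm)
    _ ≤ liminf (fun n => ∫⁻ x, eAverage T φ n x ∂m) atTop :=
        lintegral_liminf_le fun n => measurable_eAverage hT.measurable hφm n
    _ = ∫⁻ x, φ x ∂m := (tendsto_const_nhds.congr' <|
        (eventually_ne_atTop 0).mono fun n hn => (lintegral_eAverage hT hφm hn).symm).liminf_eq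

end Birkhoff

/-! ### Iterates of the shift -/

section Shift

theorem shift_iterate_apply {α : Type*} (k : ℕ) (x : ℤ → α) (i : ℤ) :
    shift^[k] x i = x (i + k) := by
  induction k generalizing x with
  | zero => simp
  | succ k ih =>
    rw [Function.iterate_succ_apply, ih, shift]
    congr 1
    push_cast
    ring

end Shift

/-! ### Stationary means and their agreement with μ on invariant events -/

section StationaryMean

variable {α : Type*} [MeasurableSpace α] {μ m : Measure (ℤ → α)}

theorem measurable_shift : Measurable (shift : (ℤ → α) → ℤ → α) :=
  measurable_pi_lambda _ fun i => measurable_pi_apply (i + 1)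

/-- An asymptotically mean stationary probability measure has a stationary mean. -/
theorem IsAMS.exists_isStationaryMean [IsProbabilityMeasure μ] (hμ : IsAMS μ) :
    ∃ m : Measure (ℤ → α), IsProbabilityMeasure m ∧ IsStationaryMean μ m := by
  -- The index is n + 1 because the empty average is the zero measure, not a probability.
  set P : ℕ → Measure (ℤ → α) := fun n =>
    ((n + 1 : ℕ) : ℝ≥0∞)⁻¹ • ∑ i ∈ Finset.range (n + 1), μ.map (shift^[i]) with hP
  have hPA : ∀ n A, MeasurableSet A → P n A = cesaro μ A (n + 1) := fun n A hA => by
    simp only [hP, Measure.smul_apply, Measure.finsetSum_apply, smul_eq_mul, cesaro]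
    rw [div_eq_mul_inv, mul_comm]
    congr 1
    exact Finset.sum_congr rfl fun i _ => Measure.map_apply (measurable_shift.iterate i) hA
  have hprob : ∀ n, IsProbabilityMeasure (P n) := fun n => ⟨by
    rw [hPA _ _ .univ]
    simp only [cesaro, Set.preimage_univ, measure_univ, Finset.sum_const, Finset.card_range,
      nsmul_eq_mul, mul_one]
    exact ENNReal.div_self (by simp) (by simp)⟩
  obtain ⟨m, hm, h⟩ := exists_setwise_limit P fun A hA => by
    obtain ⟨a, ha⟩ := hμ A hA
    exact ⟨a, by simpa only [hPA _ A hA] using! (tendsto_add_atTop_iff_nat 1).2 ha⟩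
  refine ⟨m, hm, fun A hA => (tendsto_add_atTop_iff_nat 1).1 ?_⟩
  simpa only [hPA _ A hA] using h A hA

/-- The Cesàro sums for T⁻¹A and A differ only in their end terms, which contribute at most 1/n. -/
theorem IsStationaryMean.measurePreserving [IsProbabilityMeasure μ] [IsProbabilityMeasure m]
    (h : IsStationaryMean μ m) : MeasurePreserving shift m m := by
  refine ⟨measurable_shift, Measure.ext fun A hA => ?_⟩
  rw [Measure.map_apply measurable_shift hA]
  have hsum : ∀ n, cesaro μ (shift ⁻¹' A) n + μ A / n =
      cesaro μ A n + μ (shift^[n] ⁻¹' A) / n := fun n => by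
    simp only [cesaro, ← Set.preimage_comp, ← Function.iterate_succ']
    rw [← ENNReal.add_div, ← ENNReal.add_div, ← Finset.sum_range_succ,
      Finset.sum_range_succ']
    rfl
  have h0 : ∀ u : ℕ → ℝ≥0∞, (∀ n, u n ≤ 1) → Tendsto (fun n : ℕ => u n / n) atTop (𝓝 0) :=
    fun u hu => by
      refine tendsto_of_tendsto_of_tendsto_of_le_of_le tendsto_const_nhds
        ENNReal.tendsto_inv_nat_nhds_zero (fun _ => zero_le) fun n => ?_
      rw [← one_div]
      exact ENNReal.div_le_div_right (hu n) _
  have h1 := (h _ (measurable_shift hA)).add (h0 (fun _ => μ A) fun _ => prob_le_one)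
  have h2 := (h A hA).add (h0 (fun n => μ (shift^[n] ⁻¹' A)) fun _ => prob_le_one)
  simp only [add_zero] at h1 h2
  exact tendsto_nhds_unique h1 (h2.congr fun n => (hsum n).symm)

/-- A measure and its stationary mean agree on the invariant sets. -/
theorem IsStationaryMean.measure_eq (h : IsStationaryMean μ m) {A : Set (ℤ → α)}
    (hA : MeasurableSet A) (hinv : shift ⁻¹' A = A) : μ A = m A := by
  have hi : ∀ i : ℕ, shift^[i] ⁻¹' A = A := fun i => by
    induction i with
    | zero => rfl
    | succ i ih => rw [Function.iterate_succ, Set.preimage_comp, ih, hinv]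
  refine tendsto_nhds_unique (tendsto_const_nhds.congr' ?_) (h A hA)
  filter_upwards [eventually_ne_atTop 0] with n hn
  simp only [cesaro, hi, Finset.sum_const, Finset.card_range, nsmul_eq_mul]
  rw [mul_comm, ENNReal.mul_div_cancel_right (by simpa) (by simp)]

theorem IsStationaryMean.map_eq (h : IsStationaryMean μ m) {β : Type*} [MeasurableSpace β]
    {g : (ℤ → α) → β} (hg : Measurable g) (hinv : ∀ x, g (shift x) = g x) :
    μ.map g = m.map g := by
  refine Measure.ext fun A hA => ?_
  rw [Measure.map_apply hg hA, Measure.map_apply hg hA]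
  refine h.measure_eq (hg hA) ?_
  ext x
  simp [hinv]

theorem IsStationaryMean.lintegral_eq (h : IsStationaryMean μ m) {g : (ℤ → α) → ℝ≥0∞}
    (hg : Measurable g) (hinv : ∀ x, g (shift x) = g x) : ∫⁻ x, g x ∂μ = ∫⁻ x, g x ∂m := by
  have h1 := lintegral_map (μ := μ) measurable_id hg
  have h2 := lintegral_map (μ := m) measurable_id hg
  rw [h.map_eq hg hinv] at h1
  exact h1.symm.trans h2

theorem IsStationaryMean.ae_iff (h : IsStationaryMean μ m) {p : (ℤ → α) → Prop}
    (hp : MeasurableSet {x | p x}) (hinv : ∀ x, p (shift x) ↔ p x) :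
    (∀ᵐ x ∂μ, p x) ↔ ∀ᵐ x ∂m, p x := by
  rw [MeasureTheory.ae_iff, MeasureTheory.ae_iff]
  have hc : MeasurableSet {x | ¬ p x} := hp.compl
  rw [h.measure_eq hc]
  ext x
  exact not_congr (hinv x)

/-- The left shift as a measurable equivalence. -/
def shiftEquiv (α : Type*) [MeasurableSpace α] : (ℤ → α) ≃ᵐ (ℤ → α) where
  toFun := shift
  invFun x i := x (i - 1)
  left_inv x := funext fun i => by simp [shift]
  right_inv x := funext fun i => by simp [shift]
  measurable_toFun := measurable_shift
  measurable_invFun := measurable_pi_lambda _ fun i => measurable_pi_apply (i - 1)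

theorem shiftEquiv_symm_iterate_apply (k : ℕ) (x : ℤ → α) (i : ℤ) :
    (shiftEquiv α).symm^[k] x i = x (i - k) := by
  induction k generalizing x with
  | zero => simp
  | succ k ih =>
    rw [Function.iterate_succ_apply, ih]
    change x (i - k - 1) = _
    congr 1
    push_cast
    ring

theorem measurePreserving_shiftEquiv_symm (hm : MeasurePreserving shift m m) :
    MeasurePreserving (shiftEquiv α).symm m m :=
  MeasurePreserving.symm (shiftEquiv α) hm

end StationaryMean

/-! ### Letters of a one-sided infinite concatenation -/

section Letter

variable {β : Type*}

/-- The finite concatenation `w 0 ++ ⋯ ++ w (n - 1)`. -/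
def concat (w : ℕ → List β) (n : ℕ) : List β := (List.range n).flatMap w

theorem concat_zero (w : ℕ → List β) : concat w 0 = [] := rfl

theorem concat_succ (w : ℕ → List β) (n : ℕ) : concat w (n + 1) = concat w n ++ w n := by
  simp [concat, List.range_succ]

theorem concat_succ' (w : ℕ → List β) (n : ℕ) :
    concat w (n + 1) = w 0 ++ concat (fun i => w (i + 1)) n := by
  induction n with
  | zero => simp [concat_succ, concat_zero]
  | succ n ih => rw [concat_succ, ih, concat_succ, List.append_assoc]

theorem concat_prefix (w : ℕ → List β) {i j : ℕ} (h : i ≤ j) : concat w i <+: concat w j := by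
  induction j, h using Nat.le_induction with
  | base => exact List.prefix_rfl
  | succ j _ ih => exact ih.trans (concat_succ w j ▸ List.prefix_append _ _)

theorem concat_getElem?_of_le (w : ℕ → List β) {i k j : ℕ} {a : β} (h : i ≤ k)
    (ha : (concat w i)[j]? = some a) : (concat w k)[j]? = some a := by
  obtain ⟨t, ht⟩ := concat_prefix w h
  rw [← ht, List.getElem?_append_left (List.getElem?_eq_some_iff.1 ha).1, ha]

/-- The finite concatenations are prefixes of one another, so the choice of the shortest sufficient
one is immaterial. -/
theorem letter_eq_some_iff {w : ℕ → List β} {j : ℕ} {a : β} :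
    letter w j = some a ↔ ∃ n, (concat w n)[j]? = some a := by
  refine ⟨fun h => ⟨_, h⟩, fun ⟨n, hn⟩ => ?_⟩
  have hne : {n | j < ((List.range n).flatMap w).length}.Nonempty :=
    ⟨n, (List.getElem?_eq_some_iff.1 hn).1⟩
  have hmem : j < (concat w (sInf {n | j < ((List.range n).flatMap w).length})).length :=
    Nat.sInf_mem hne
  have hle : sInf {n | j < ((List.range n).flatMap w).length} ≤ n :=
    Nat.sInf_le (List.getElem?_eq_some_iff.1 hn).1
  have h2 := concat_getElem?_of_le w hle (List.getElem?_eq_getElem hmem)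
  rw [hn, Option.some.injEq] at h2
  rw [h2]
  exact List.getElem?_eq_getElem hmem

theorem letter_isSome_iff {w : ℕ → List β} {j : ℕ} :
    (letter w j).isSome ↔ ∃ n, j < (concat w n).length := by
  simp only [Option.isSome_iff_exists, letter_eq_some_iff, List.getElem?_eq_some_iff]
  exact ⟨fun ⟨_, n, h, _⟩ => ⟨n, h⟩, fun ⟨n, h⟩ => ⟨_, n, h, rfl⟩⟩

theorem letter_add_length (w : ℕ → List β) (j : ℕ) :
    letter w (j + (w 0).length) = letter (fun i => w (i + 1)) j := by
  refine Option.ext fun a => ?_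
  simp only [letter_eq_some_iff]
  constructor
  · rintro ⟨n, hn⟩
    have := concat_getElem?_of_le w (Nat.le_succ n) hn
    rw [concat_succ', List.getElem?_append_right (by omega), Nat.add_sub_cancel] at this
    exact ⟨n, this⟩
  · rintro ⟨n, hn⟩
    refine ⟨n + 1, ?_⟩
    rw [concat_succ', List.getElem?_append_right (by omega), Nat.add_sub_cancel, hn]

theorem letter_of_lt_length {w : ℕ → List β} {j : ℕ} (h : j < (w 0).length) :
    letter w j = some (w 0)[j] := by
  rw [letter_eq_some_iff]
  exact ⟨1, by simp [concat_succ, concat_zero, h]⟩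

theorem forall_letter_isSome_iff {w : ℕ → List β} :
    (∀ j, (letter w j).isSome) ↔ ∃ᶠ i in atTop, w i ≠ [] := by
  simp only [letter_isSome_iff]
  have hmono : Monotone fun n => (concat w n).length := fun i j h => (concat_prefix w h).length_le
  constructor
  · intro h
    by_contra hc
    obtain ⟨N, hN⟩ := eventually_atTop.1 (not_frequently.1 hc)
    obtain ⟨n, hn⟩ := h (concat w N).length
    have : ∀ k, N ≤ k → concat w k = concat w N := by
      intro k hk
      induction k, hk using Nat.le_induction with
      | base => rfl
      | succ k hk ih => rw [concat_succ, not_not.1 (hN k hk), List.append_nil, ih]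
    rcases le_total N n with h' | h'
    · rw [this n h'] at hn
      exact lt_irrefl _ hn
    · exact absurd (hmono h') (not_le.2 hn)
  · intro h j
    induction j with
    | zero =>
      obtain ⟨i, hi⟩ := h.exists
      exact ⟨i + 1, by rw [concat_succ, List.length_append]; have := List.length_pos_iff.2 hi; omega⟩
    | succ j ih =>
      obtain ⟨n, hn⟩ := ih
      obtain ⟨i, hni, hi⟩ := frequently_atTop.1 h n
      refine ⟨i + 1, ?_⟩
      have h1 := hmono hni
      have h2 := List.length_pos_iff.2 hi
      simp only at h1
      rw [concat_succ, List.length_append]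
      omega

end Letter

/-! ### The coded sequence, its cocycle identities and the visit counts -/

section Extension

variable {X Y : Type*} (f : X → List Y)

theorem extZ_add_one (x : ℤ → X) (j : ℕ) :
    extZ f x (j + 1) = letter (fun i : ℕ => f (x ((i : ℤ) + 1))) j := by
  simp [extZ]

theorem extZ_neg (x : ℤ → X) (j : ℕ) :
    extZ f x (-j) = letter (fun i : ℕ => (f (x (-(i : ℤ)))).reverse) j := by
  rw [extZ, if_neg (by omega)]
  simp

/-- Coding commutes with shifting the source by one letter, which shifts the code by the length of
one codeword. -/
theorem extZ_shift (x : ℤ → X) : extZ f (shift x) = shift^[(f (x 1)).length] (extZ f x) := by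
  funext i
  rw [shift_iterate_apply]
  set l := (f (x 1)).length with hl
  rcases lt_or_ge 0 i with hi | hi
  · obtain ⟨j, rfl⟩ : ∃ j : ℕ, i = j + 1 := ⟨(i - 1).toNat, by omega⟩
    rw [show (j : ℤ) + 1 + l = ((j + l : ℕ) : ℤ) + 1 by push_cast; ring, extZ_add_one,
      extZ_add_one]
    have := letter_add_length (fun i : ℕ => f (x ((i : ℤ) + 1))) j
    simp only [Nat.cast_zero, zero_add] at this
    rw [hl, this]
    simp [shift]
  · obtain ⟨j, rfl⟩ : ∃ j : ℕ, i = -j := ⟨(-i).toNat, by omega⟩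
    rw [extZ_neg]
    rcases lt_or_ge j l with hj | hj
    -- The position crosses the dot: the left half of the shifted code starts with f(x_1) reversed,
    -- whose letter j is letter l - 1 - j of f(x_1).
    · rw [show -(j : ℤ) + l = ((l - 1 - j : ℕ) : ℤ) + 1 by omega, extZ_add_one,
        letter_of_lt_length (by simpa [shift] using hj),
        letter_of_lt_length (by simp; omega)]
      simp [shift, hl]
    · obtain ⟨k, rfl⟩ := Nat.exists_eq_add_of_le' hj
      rw [show -((k + l : ℕ) : ℤ) + l = -(k : ℤ) by push_cast; ring, extZ_neg]
      have := letter_add_length (fun i : ℕ => (f (shift x (-(i : ℤ)))).reverse) k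
      have h0 : (f (shift x (-((0 : ℕ) : ℤ)))).reverse.length = l := by simp [shift, hl]
      rw [h0] at this
      rw [this]
      congr 1
      funext i
      simp only [shift]
      congr 3
      push_cast
      ring

/-- The sequences that are coded by genuine two-sided sequences. -/
def properSet : Set (ℤ → X) := {x | ∀ j, (extZ f x j).isSome}

theorem mem_properSet_iff {x : ℤ → X} :
    x ∈ properSet f ↔ (∃ᶠ i : ℕ in atTop, f (x (i + 1)) ≠ []) ∧
      ∃ᶠ i : ℕ in atTop, f (x (-i)) ≠ [] := by
  have h1 := forall_letter_isSome_iff (w := fun i : ℕ => f (x ((i : ℤ) + 1)))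
  have h2 := forall_letter_isSome_iff (w := fun i : ℕ => (f (x (-(i : ℤ)))).reverse)
  simp only [ne_eq, List.reverse_eq_nil_iff] at h2
  simp only [← extZ_add_one] at h1
  simp only [← extZ_neg] at h2
  rw [← h1, ← h2]
  refine ⟨fun h => ⟨fun j => h _, fun j => h _⟩, fun h j => ?_⟩
  rcases lt_or_ge 0 j with hj | hj
  · obtain ⟨k, rfl⟩ : ∃ k : ℕ, j = k + 1 := ⟨(j - 1).toNat, by omega⟩
    exact h.1 k
  · obtain ⟨k, rfl⟩ : ∃ k : ℕ, j = -k := ⟨(-j).toNat, by omega⟩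
    exact h.2 k

theorem shift_mem_properSet_iff {x : ℤ → X} : shift x ∈ properSet f ↔ x ∈ properSet f := by
  simp only [properSet, extZ_shift, Set.mem_ofPred_eq, shift_iterate_apply]
  exact ⟨fun h j => by simpa using h (j - (f (x 1)).length), fun h j => h _⟩

theorem shift_iterate_mem_properSet_iff {x : ℤ → X} (k : ℕ) :
    shift^[k] x ∈ properSet f ↔ x ∈ properSet f := by
  induction k with
  | zero => rfl
  | succ k ih => rw [Function.iterate_succ_apply', shift_mem_properSet_iff, ih]

/-- The coded sequence, with a default value at the positions beyond the end of a finite half. -/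
noncomputable def decode [Inhabited Y] (x : ℤ → X) : ℤ → Y := fun j => (extZ f x j).getD default

/-- This replaces the option-valued code by the total map `decode`; its default letter is harmless
because membership in `properSet` is recorded separately. -/
theorem shift_iterate_extZ_mem_iff [Inhabited Y] {A : Set (ℤ → Y)} {k : ℕ} {x : ℤ → X} :
    shift^[k] (extZ f x) ∈ toOpt '' A ↔ x ∈ properSet f ∧ shift^[k] (decode f x) ∈ A := by
  constructor
  · rintro ⟨y, hy, h⟩
    have hj : ∀ j, extZ f x (j + k) = some (y j) := fun j => by
      rw [← shift_iterate_apply k (extZ f x) j, ← h]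
      rfl
    refine ⟨fun j => ?_, ?_⟩
    · have := hj (j - k)
      rw [sub_add_cancel] at this
      simp [this]
    · convert hy
      funext j
      rw [shift_iterate_apply, decode, hj]
      rfl
  · rintro ⟨h1, h2⟩
    refine ⟨_, h2, ?_⟩
    funext j
    simp only [toOpt, shift_iterate_apply, decode]
    obtain ⟨a, ha⟩ := Option.isSome_iff_exists.1 (h1 (j + k))
    simp [ha]

theorem F_eq_indicator [Inhabited Y] (A : Set (ℤ → Y)) (k : ℕ) :
    F f A k = (properSet f ∩ (fun x => shift^[k] (decode f x)) ⁻¹' A).indicator 1 := by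
  funext x
  rw [F]
  congr 1
  ext x
  exact shift_iterate_extZ_mem_iff f

theorem F_shift (A : Set (ℤ → Y)) (k : ℕ) (x : ℤ → X) :
    F f A k (shift x) = F f A (k + (f (x 1)).length) x := by
  simp only [F, Set.indicator, Set.mem_ofPred_eq, Pi.one_apply]
  congr 1
  rw [extZ_shift, Function.iterate_add_apply]

theorem F_preimage_shift (A : Set (ℤ → Y)) (k : ℕ) (x : ℤ → X) :
    F f (shift ⁻¹' A) k x = F f A (k + 1) x := by
  simp only [F, Set.indicator, Set.mem_ofPred_eq]
  congr 1
  rw [Function.iterate_succ_apply']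
  refine propext ⟨?_, ?_⟩
  · rintro ⟨y, hy, h⟩
    exact ⟨shift y, hy, by rw [← h]; rfl⟩
  · rintro ⟨y, hy, h⟩
    refine ⟨fun i => y (i - 1), ?_, ?_⟩
    · change shift _ ∈ A
      convert hy
      funext i
      simp [shift]
    · funext i
      have := congrFun h (i - 1)
      simpa [toOpt, shift] using this

theorem F_preimage_shift_iterate (A : Set (ℤ → Y)) (i k : ℕ) (x : ℤ → X) :
    F f (shift^[i] ⁻¹' A) k x = F f A (k + i) x := by
  induction i generalizing k with
  | zero => rfl
  | succ i ih =>
    rw [Function.iterate_succ, Set.preimage_comp, F_preimage_shift, ih]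
    congr 1
    omega

theorem F_le_one (A : Set (ℤ → Y)) (k : ℕ) (x : ℤ → X) : F f A k x ≤ 1 :=
  Set.indicator_le_self' (fun _ _ => zero_le) x

theorem G_le (A : Set (ℤ → Y)) (x : ℤ → X) : G f A x ≤ (f (x 1)).length := by
  refine (Finset.sum_le_card_nsmul _ _ 1 fun k _ => F_le_one f A k x).trans ?_
  simp

theorem G_ne_top (A : Set (ℤ → Y)) (x : ℤ → X) : G f A x ≠ ∞ :=
  ((G_le f A x).trans_lt (ENNReal.natCast_lt_top _)).ne

/-- Both sides are the sum of `F` over the positions 0, …, |f(x_1)|, with the first or the last term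
split off. The extra terms are a function and its composition with the shift, so they have equal
integrals under an invariant measure. -/
theorem G_preimage_shift (A : Set (ℤ → Y)) (x : ℤ → X) :
    G f (shift ⁻¹' A) x + F f A 0 x = G f A x + F f A 0 (shift x) := by
  rw [F_shift, zero_add, G, G, ← Finset.sum_range_succ, Finset.sum_range_succ']
  simp only [F_preimage_shift]

theorem S_eq_birkhoffSum (x : ℤ → X) (n : ℕ) :
    S f x n = birkhoffSum shift (fun x => (f (x 1)).length) n x := by
  induction n with
  | zero => simp [S]
  | succ n ih =>
    rw [birkhoffSum_succ, ← ih, S, Finset.sum_Icc_succ_top (by omega), S, shift_iterate_apply]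
    congr 4
    push_cast
    ring

theorem S_div_eq_eAverage (x : ℤ → X) (n : ℕ) :
    (S f x n : ℝ≥0∞) / n = eAverage shift (fun x => ((f (x 1)).length : ℝ≥0∞)) n x := by
  rw [S_eq_birkhoffSum, eAverage, birkhoffSum, birkhoffSum, Nat.cast_sum]

/-- By `F_shift` the blocks counted by successive terms are adjacent and together fill an initial
segment of positions. -/
theorem birkhoffSum_G (A : Set (ℤ → Y)) (x : ℤ → X) (n : ℕ) :
    birkhoffSum shift (G f A) n x = ∑ k ∈ Finset.range (S f x n), F f A k x := by
  rw [S_eq_birkhoffSum]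
  induction n generalizing x with
  | zero => simp
  | succ n ih =>
    rw [birkhoffSum_succ', birkhoffSum_succ', ih, Finset.sum_range_add, G]
    congr 1
    exact Finset.sum_congr rfl fun k _ => by rw [F_shift, add_comm]

/-- The summation bound, which depends on x, moves into an indicator; measurability and the exchange
of sum and integral follow. -/
theorem G_eq_tsum (A : Set (ℤ → Y)) (x : ℤ → X) :
    G f A x = ∑' k, {x : ℤ → X | k < (f (x 1)).length}.indicator (F f A k) x := by
  rw [tsum_eq_sum (s := Finset.range (f (x 1)).length)]
  · exact Finset.sum_congr rfl fun k hk => (Set.indicator_of_mem (by simpa using hk) _).symm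
  · intro k hk
    exact Set.indicator_of_notMem (by simpa using hk) _

theorem rate_eq (x : ℤ → X) :
    rate f x = limsup (fun n => eAverage shift (fun x => ((f (x 1)).length : ℝ≥0∞)) n x) atTop := by
  simp only [rate, S_div_eq_eAverage]

theorem rate_shift (x : ℤ → X) : rate f (shift x) = rate f x := by
  rw [rate_eq, rate_eq]
  exact limsup_eAverage_comp (fun x => ENNReal.natCast_ne_top _) x

theorem G_univ_of_mem_properSet {x : ℤ → X} (hx : f (x 1) ≠ [] → x ∈ properSet f) :
    G f Set.univ x = (f (x 1)).length := by
  rcases eq_or_ne (f (x 1)) [] with h | h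
  · simp [G, h]
  · have : Nonempty Y := ⟨(f (x 1)).head h⟩
    inhabit Y
    simp [G, F_eq_indicator, hx h]

end Extension

/-! ### Measurability of the coding -/

section Measurability

variable {X Y : Type*} [MeasurableSpace X] [DiscreteMeasurableSpace X] (f : X → List Y)

theorem measurableSet_coord (i : ℤ) (p : X → Prop) : MeasurableSet {x : ℤ → X | p (x i)} := by
  have h : MeasurableSet {y | p y} := .of_discrete
  exact measurable_pi_apply i h

/-- There are only countably many finite strings over Y, so the event is a countable union over the
ways to split l. -/
theorem measurableSet_concat_eq [Countable Y] {Ω : Type*} [MeasurableSpace Ω]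
    {w : Ω → ℕ → List Y} (hw : ∀ i l, MeasurableSet {x | w x i = l}) (n : ℕ) (l : List Y) :
    MeasurableSet {x | concat (w x) n = l} := by
  induction n generalizing l with
  | zero => simp [concat_zero]
  | succ n ih =>
    have : {x | concat (w x) (n + 1) = l} =
        ⋃ p : List Y × List Y, ⋃ _ : p.1 ++ p.2 = l,
          {x | concat (w x) n = p.1} ∩ {x | w x n = p.2} := by
      ext x
      simp only [concat_succ, Set.mem_iUnion, Set.mem_inter_iff, Set.mem_ofPred_eq]
      exact ⟨fun h => ⟨(_, _), h, rfl, rfl⟩, fun ⟨p, h, h1, h2⟩ => by rw [h1, h2, h]⟩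
    rw [this]
    exact .iUnion fun p => .iUnion fun _ => (ih p.1).inter (hw n p.2)

theorem measurableSet_letter_eq_some [Countable Y] {Ω : Type*} [MeasurableSpace Ω]
    {w : Ω → ℕ → List Y} (hw : ∀ i l, MeasurableSet {x | w x i = l}) (j : ℕ) (a : Y) :
    MeasurableSet {x | letter (w x) j = some a} := by
  have : {x | letter (w x) j = some a} =
      ⋃ n : ℕ, ⋃ l : List Y, ⋃ _ : l[j]? = some a, {x | concat (w x) n = l} := by
    ext x
    simp only [letter_eq_some_iff, Set.mem_iUnion, Set.mem_ofPred_eq]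
    exact ⟨fun ⟨n, h⟩ => ⟨n, _, h, rfl⟩, fun ⟨n, l, h, h'⟩ => ⟨n, h' ▸ h⟩⟩
  rw [this]
  exact .iUnion fun n => .iUnion fun l => .iUnion fun _ => measurableSet_concat_eq hw n l

theorem measurableSet_extZ_eq_some [Countable Y] (j : ℤ) (a : Y) :
    MeasurableSet {x : ℤ → X | extZ f x j = some a} := by
  rcases lt_or_ge 0 j with hj | hj
  · obtain ⟨k, rfl⟩ : ∃ k : ℕ, j = k + 1 := ⟨(j - 1).toNat, by omega⟩
    simp only [extZ_add_one]
    exact measurableSet_letter_eq_some (fun i l => measurableSet_coord _ fun y => f y = l) k a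
  · obtain ⟨k, rfl⟩ : ∃ k : ℕ, j = -k := ⟨(-j).toNat, by omega⟩
    simp only [extZ_neg]
    exact measurableSet_letter_eq_some (fun i l => measurableSet_coord _ fun y => (f y).reverse = l) k a

theorem measurableSet_properSet [Countable Y] : MeasurableSet (properSet f) := by
  have : properSet f = ⋂ j, ⋃ a, {x | extZ f x j = some a} := by
    ext x
    simp [properSet, Option.isSome_iff_exists]
  rw [this]
  exact .iInter fun j => .iUnion fun a => measurableSet_extZ_eq_some f j a

theorem measurable_decode [Countable Y] [Inhabited Y] [MeasurableSpace Y]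
    [DiscreteMeasurableSpace Y] : Measurable (decode f) := by
  refine measurable_pi_lambda _ fun j => measurable_to_countable' fun a => ?_
  have hn : MeasurableSet {x | extZ f x j = none} := by
    have : {x | extZ f x j = none} = (⋃ a, {x | extZ f x j = some a})ᶜ := by
      ext x
      simp [Option.eq_none_iff_forall_ne_some]
    rw [this]
    exact (MeasurableSet.iUnion fun a => measurableSet_extZ_eq_some f j a).compl
  have : (fun x => decode f x j) ⁻¹' {a} =
      {x | extZ f x j = some a} ∪ ({x | extZ f x j = none} ∩ {_x | default = a}) := by
    ext x
    simp only [decode, Set.mem_preimage, Set.mem_singleton_iff, Set.mem_union, Set.mem_ofPred_eq,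
      Set.mem_inter_iff]
    cases extZ f x j <;> simp
  rw [this]
  exact (measurableSet_extZ_eq_some f j a).union (hn.inter (.const _))

theorem measurable_length :
    Measurable fun x : ℤ → X => ((f (x 1)).length : ℝ≥0∞) :=
  (Measurable.of_discrete (f := fun y : X => ((f y).length : ℝ≥0∞))).comp (measurable_pi_apply 1)

theorem measurable_F [Countable Y] [Inhabited Y] [MeasurableSpace Y] [DiscreteMeasurableSpace Y]
    {A : Set (ℤ → Y)} (hA : MeasurableSet A) (k : ℕ) : Measurable (F f A k) := by
  rw [F_eq_indicator]
  exact measurable_one.indicator ((measurableSet_properSet f).inter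
    (((measurable_shift.iterate k).comp (measurable_decode f)) hA))

theorem measurableSet_lt_length (k : ℕ) :
    MeasurableSet {x : ℤ → X | k < (f (x 1)).length} :=
  measurableSet_coord 1 fun y => k < (f y).length

theorem measurable_G [Countable Y] [Inhabited Y] [MeasurableSpace Y] [DiscreteMeasurableSpace Y]
    {A : Set (ℤ → Y)} (hA : MeasurableSet A) : Measurable (G f A) := by
  rw [funext (G_eq_tsum f A)]
  exact .tsum fun k => (measurable_F f hA k).indicator (measurableSet_lt_length f k)

theorem measurable_rate : Measurable (rate f : (ℤ → X) → ℝ≥0∞) := by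
  rw [funext (rate_eq f)]
  exact .limsup fun n => measurable_eAverage measurable_shift (measurable_length f) n

end Measurability

/-! ### The unnormalised measure ρ under a stationary source -/

section Stationary

variable {X Y : Type*} [MeasurableSpace X] [DiscreteMeasurableSpace X] (f : X → List Y)
  {m : Measure (ℤ → X)}

/-- Poincaré recurrence for the shift and for its inverse: a nonempty codeword at coordinate 1 is
followed and preceded by infinitely many others. -/
theorem ae_mem_properSet_of_ne_nil [IsFiniteMeasure m] (hm : MeasurePreserving shift m m) :
    ∀ᵐ x ∂m, f (x 1) ≠ [] → x ∈ properSet f := by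
  have hs : MeasurableSet {x : ℤ → X | f (x 1) ≠ []} :=
    measurableSet_coord 1 fun y => f y ≠ []
  filter_upwards [hm.conservative.ae_mem_imp_frequently_image_mem hs.nullMeasurableSet,
    (measurePreserving_shiftEquiv_symm hm).conservative.ae_mem_imp_frequently_image_mem
      hs.nullMeasurableSet] with x h1 h2 hx
  rw [mem_properSet_iff]
  constructor
  · refine (h1 hx).mono fun n hn => ?_
    simpa [shift_iterate_apply, add_comm] using hn
  · have h3 := h2 hx
    -- The n-th inverse iterate reads coordinate 1 - n, whereas the left half is indexed by -n.
    rw [← map_add_atTop_eq_nat 1, frequently_map] at h3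
    refine h3.mono fun n hn => ?_
    simpa [shiftEquiv_symm_iterate_apply] using hn

/-- If x were not proper, recurrence along the whole forward orbit would make every f(x_k) with k ≥
1 empty, and the rate would be 0. -/
theorem ae_mem_properSet_of_rate_pos [IsFiniteMeasure m] (hm : MeasurePreserving shift m m)
    (h : ∀ᵐ x ∂m, rate f x ≠ 0) : ∀ᵐ x ∂m, x ∈ properSet f := by
  filter_upwards [h, ae_forall_iterate hm (ae_mem_properSet_of_ne_nil f hm)] with x hx hp
  by_contra hc
  refine hx ?_
  have hl : ∀ k : ℕ, f (shift^[k] x 1) = [] := fun k => by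
    by_contra hk
    exact hc ((shift_iterate_mem_properSet_iff f k).1 (hp k hk))
  rw [rate_eq]
  simp [eAverage, birkhoffSum, hl]

variable [MeasurableSpace Y]

/-- The measure `A ↦ ∫ G(A, x) dm`. -/
noncomputable def blockMeasure [Inhabited Y] (m : Measure (ℤ → X)) : Measure (ℤ → Y) :=
  Measure.sum fun k : ℕ =>
    (m.restrict (properSet f ∩ {x | k < (f (x 1)).length})).map fun x => shift^[k] (decode f x)

variable [Countable Y] [DiscreteMeasurableSpace Y] [Inhabited Y]

theorem blockMeasure_apply {A : Set (ℤ → Y)} (hA : MeasurableSet A) :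
    blockMeasure f m A = ∫⁻ x, G f A x ∂m := by
  have hd : ∀ k : ℕ, Measurable fun x : ℤ → X => shift^[k] (decode f x) := fun k =>
    (measurable_shift.iterate k).comp (measurable_decode f)
  rw [blockMeasure, Measure.sum_apply _ hA]
  simp only [G_eq_tsum]
  rw [lintegral_tsum fun k =>
    ((measurable_F f hA k).indicator (measurableSet_lt_length f k)).aemeasurable]
  refine tsum_congr fun k => ?_
  rw [Measure.map_apply (hd k) hA, Measure.restrict_apply (hd k hA), F_eq_indicator,
    Set.indicator_indicator, lintegral_indicator_one
      ((measurableSet_lt_length f k).inter ((measurableSet_properSet f).inter (hd k hA)))]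
  congr 1
  ext x
  simp only [Set.mem_inter_iff]
  tauto

theorem blockMeasure_univ [IsFiniteMeasure m] (hm : MeasurePreserving shift m m) :
    (blockMeasure f m : Measure (ℤ → Y)) Set.univ = ∫⁻ x, ((f (x 1)).length : ℝ≥0∞) ∂m := by
  rw [blockMeasure_apply f .univ]
  exact lintegral_congr_ae ((ae_mem_properSet_of_ne_nil f hm).mono fun x hx =>
    G_univ_of_mem_properSet f hx)

/-- Integrate the coboundary identity `G_preimage_shift` and cancel the boundary terms, which are
finite because `F` ≤ 1. -/
theorem measurePreserving_blockMeasure [IsFiniteMeasure m] (hm : MeasurePreserving shift m m) :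
    MeasurePreserving shift (blockMeasure f m : Measure (ℤ → Y)) (blockMeasure f m) := by
  refine ⟨measurable_shift, Measure.ext fun A hA => ?_⟩
  rw [Measure.map_apply measurable_shift hA, blockMeasure_apply f (measurable_shift hA),
    blockMeasure_apply f hA]
  have hF := measurable_F f hA 0
  have hFs : Measurable fun x => F f A 0 (shift x) := hF.comp measurable_shift
  have h := lintegral_congr (μ := m) (G_preimage_shift f A)
  rw [lintegral_add_right _ hF, lintegral_add_right _ hFs,
    hm.lintegral_comp hF] at h
  refine (ENNReal.add_left_inj ?_).1 h
  refine ((lintegral_mono (F_le_one f A 0)).trans_lt ?_).ne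
  simp

end Stationary

/-! ### From codeword time to letter time -/

section TimeChange

/-- Averages along the natural times from averages along times that grow at a linear rate. -/
theorem tendsto_average_of_time_change {b : ℕ → ℝ} (hb0 : ∀ i, 0 ≤ b i) (hb1 : ∀ i, b i ≤ 1)
    {s : ℕ → ℕ} {L c : ℝ} (hL : 0 < L) (hs : Tendsto (fun n => (s n : ℝ) / n) atTop (𝓝 L))
    (hc : Tendsto (fun n : ℕ => (∑ i ∈ Finset.range (s n), b i) / n) atTop (𝓝 c)) :
    Tendsto (fun n : ℕ => (∑ i ∈ Finset.range n, b i) / n) atTop (𝓝 (c / L)) := by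
  set B : ℕ → ℝ := fun n => ∑ i ∈ Finset.range n, b i with hB
  have hBle : ∀ i j, i ≤ j → |B j - B i| ≤ (j : ℝ) - i := fun i j hij => by
    rw [hB]
    simp only
    rw [← Finset.sum_Ico_eq_sub _ hij, abs_of_nonneg (Finset.sum_nonneg fun k _ => hb0 k)]
    refine (Finset.sum_le_card_nsmul _ _ 1 fun k _ => hb1 k).trans ?_
    rw [Nat.card_Ico, nsmul_eq_mul, mul_one, Nat.cast_sub hij]
  have hBlip : ∀ i j, |B j - B i| ≤ |(j : ℝ) - i| := fun i j => by
    rcases le_total i j with h | h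
    · exact (hBle i j h).trans (le_abs_self _)
    · rw [abs_sub_comm, abs_sub_comm (j : ℝ)]
      exact (hBle j i h).trans (le_abs_self _)
  -- With about n/L codewords the code has length s(N n) ~ n. The partial sums B are 1-Lipschitz, so
  -- B n and B (s (N n)) differ by o(n).
  set N : ℕ → ℕ := fun n => ⌊L⁻¹ * n⌋₊ with hN
  have hNdiv : Tendsto (fun n : ℕ => (N n : ℝ) / n) atTop (𝓝 L⁻¹) :=
    (tendsto_nat_floor_mul_div_atTop (inv_nonneg.2 hL.le)).comp tendsto_natCast_atTop_atTop
  have hNtop : Tendsto N atTop atTop :=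
    tendsto_nat_floor_atTop.comp
      (tendsto_natCast_atTop_atTop.const_mul_atTop (inv_pos.2 hL))
  have hmul : ∀ u : ℕ → ℝ, ∀ d, Tendsto (fun n => u n / n) atTop (𝓝 d) →
      Tendsto (fun n => u (N n) / n) atTop (𝓝 (d * L⁻¹)) := fun u d hu => by
    refine ((hu.comp hNtop).mul hNdiv).congr' ?_
    filter_upwards [hNtop.eventually_ne_atTop 0] with n hn
    have : (N n : ℝ) ≠ 0 := by exact_mod_cast hn
    simp only [Function.comp_apply]
    field_simp
  have h1 := hmul (fun n => s n) L hs
  have h2 := hmul (fun n => B (s n)) c hc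
  rw [mul_inv_cancel₀ hL.ne'] at h1
  have h3 : Tendsto (fun n : ℕ => B n / n - B (s (N n)) / n) atTop (𝓝 0) := by
    have h4 : Tendsto (fun n : ℕ => |1 - (s (N n) : ℝ) / n|) atTop (𝓝 0) := by
      simpa using (h1.const_sub 1).abs
    refine squeeze_zero_norm' ?_ h4
    filter_upwards [eventually_gt_atTop 0] with n hn
    have hn' : (0 : ℝ) < n := by exact_mod_cast hn
    have h5 : 1 - (s (N n) : ℝ) / n = ((n : ℝ) - s (N n)) / n := by field_simp
    rw [Real.norm_eq_abs, ← sub_div, h5, abs_div, abs_div, abs_of_pos hn']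
    exact div_le_div_of_nonneg_right (hBlip _ _) hn'.le
  have h6 := h3.add h2
  simp only [sub_add_cancel, zero_add] at h6
  rwa [div_eq_mul_inv]

theorem tendsto_eaverage_of_time_change {a : ℕ → ℝ≥0∞} (ha : ∀ i, a i ≤ 1)
    {s : ℕ → ℕ} {L c : ℝ≥0∞} (hL0 : L ≠ 0) (hL : L ≠ ∞)
    (hs : Tendsto (fun n => (s n : ℝ≥0∞) / n) atTop (𝓝 L))
    (hc : Tendsto (fun n : ℕ => (∑ i ∈ Finset.range (s n), a i) / n) atTop (𝓝 c)) :
    Tendsto (fun n : ℕ => (∑ i ∈ Finset.range n, a i) / n) atTop (𝓝 (c / L)) := by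
  have hfin : ∀ i, a i ≠ ∞ := fun i => ((ha i).trans_lt ENNReal.one_lt_top).ne
  have hcL : c ≤ L := by
    refine le_of_tendsto_of_tendsto' hc hs fun n => ENNReal.div_le_div_right ?_ _
    exact (Finset.sum_le_card_nsmul _ _ 1 fun k _ => ha k).trans (by simp)
  have hct : c ≠ ∞ := (hcL.trans_lt hL.lt_top).ne
  have hreal : ∀ k n : ℕ, ((∑ i ∈ Finset.range k, a i) / (n : ℝ≥0∞)).toReal =
      (∑ i ∈ Finset.range k, (a i).toReal) / n := fun k n => by
    rw [ENNReal.toReal_div, ENNReal.toReal_sum fun i _ => hfin i, ENNReal.toReal_natCast]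
  have h := tendsto_average_of_time_change (b := fun i => (a i).toReal) (s := s)
    (fun i => ENNReal.toReal_nonneg)
    (fun i => ENNReal.toReal_le_of_le_ofReal zero_le_one (by simpa using ha i))
    (ENNReal.toReal_pos hL0 hL)
    (by simpa [Function.comp_def, ENNReal.toReal_div] using (ENNReal.tendsto_toReal hL).comp hs)
    (by simpa only [Function.comp_def, hreal] using (ENNReal.tendsto_toReal hct).comp hc)
  simp only [← hreal] at h
  rw [← ENNReal.toReal_div] at h
  have hdiv : c / L ≠ ∞ := ENNReal.div_ne_top hct hL0
  rw [← tendsto_add_atTop_iff_nat 1] at h ⊢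
  refine (ENNReal.tendsto_toReal_iff (fun n => ?_) hdiv).1 h
  exact ENNReal.div_ne_top (ENNReal.sum_ne_top.2 fun i _ => hfin i) (by simp)

end TimeChange

/-! ### The uniform shift within a codeword -/

section RandomShift

/-- For an empty codeword both sides are 0: `uniformOn ∅` is the zero measure, and on the right ∞ ·
0 = 0. -/
theorem lintegral_F_uniformOn {X Y : Type*} (f : X → List Y) (A : Set (ℤ → Y)) (x : ℤ → X) :
    ∫⁻ k, F f A k x ∂(uniformOn (Set.Iio (f (x 1)).length)) =
      ((f (x 1)).length : ℝ≥0∞)⁻¹ * G f A x := by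
  have hset : Set.Iio (f (x 1)).length = (Finset.range (f (x 1)).length : Set ℕ) := by
    ext; simp
  rw [uniformOn, ProbabilityTheory.cond, lintegral_smul_measure, hset, Measure.count_apply_finset,
    lintegral_finset, Finset.card_range, smul_eq_mul, G]
  simp

end RandomShift

/-! ### The coded measure and its Cesàro limits -/

section CodedMeasure

variable {X : Type*} [MeasurableSpace X] {μ m : Measure (ℤ → X)}

/-- Averages that are integrable with respect to the stationary mean converge almost surely with
respect to the original measure. -/
theorem IsStationaryMean.ae_tendsto_eAverage [IsFiniteMeasure m] (h : IsStationaryMean μ m)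
    (hm : MeasurePreserving shift m m) {φ : (ℤ → X) → ℝ≥0∞} (hφm : Measurable φ)
    (hφ : ∀ x, φ x ≠ ∞) (hint : ∫⁻ x, φ x ∂m ≠ ∞) :
    ∀ᵐ x ∂μ, Tendsto (fun n => eAverage shift φ n x) atTop
      (𝓝 (limsup (fun n => eAverage shift φ n x) atTop)) := by
  have hmeas : ∀ n, Measurable (eAverage shift φ n) := measurable_eAverage measurable_shift hφm
  have h1 : ∀ᵐ x ∂m, limsup (fun n => eAverage shift φ n x) atTop ≤
      liminf (fun n => eAverage shift φ n x) atTop :=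
    (VLC.ae_tendsto_eAverage hm hφm hφ hint).mono fun x hx => hx.liminf_eq.ge
  -- Convergence, written as limsup ≤ liminf, is an invariant event, so it passes from m to μ.
  rw [← h.ae_iff (measurableSet_le (.limsup hmeas) (.liminf hmeas)) fun x => by
    rw [limsup_eAverage_comp hφ, liminf_eAverage_comp hφ]] at h1
  exact h1.mono fun x hx => tendsto_of_le_liminf_of_limsup_le hx le_rfl

variable {Y : Type*} [DiscreteMeasurableSpace X] [Countable Y] [Inhabited Y] [MeasurableSpace Y]
  [DiscreteMeasurableSpace Y] (f : X → List Y)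

theorem isCodedMeasure_map_decode (hμ : ∀ᵐ x ∂μ, x ∈ properSet f) :
    IsCodedMeasure f μ (μ.map (decode f) : Measure (ℤ → Y)) := by
  intro A hA
  rw [Measure.map_apply (measurable_decode f) hA]
  refine measure_congr (hμ.mono fun x hx => propext ?_)
  have := shift_iterate_extZ_mem_iff f (A := A) (k := 0) (x := x)
  simp only [Function.iterate_zero, id] at this
  exact ⟨fun h => this.2 ⟨hx, h⟩, fun h => (this.1 h).2⟩

theorem IsCodedMeasure.measure_preimage_shift_iterate {ν : Measure (ℤ → Y)}
    (hν : IsCodedMeasure f μ ν) {A : Set (ℤ → Y)} (hA : MeasurableSet A) (i : ℕ) :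
    ν (shift^[i] ⁻¹' A) = ∫⁻ x, F f A i x ∂μ := by
  have hAi := measurable_shift.iterate i hA
  have hs : MeasurableSet (extZ f ⁻¹' (toOpt '' (shift^[i] ⁻¹' A))) := by
    have : extZ f ⁻¹' (toOpt '' (shift^[i] ⁻¹' A)) =
        properSet f ∩ decode f ⁻¹' (shift^[i] ⁻¹' A) := by
      ext x
      exact shift_iterate_extZ_mem_iff f (k := 0)
    rw [this]
    exact (measurableSet_properSet f).inter (measurable_decode f hAi)
  rw [hν _ hAi, ← lintegral_indicator_one hs]
  refine lintegral_congr fun x => ?_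
  rw [← zero_add i, ← F_preimage_shift_iterate, zero_add]
  rfl

/-- The stationary mean of the coded measure, if the expansion rate is constant. -/
theorem tendsto_cesaro_codedMeasure [IsProbabilityMeasure μ] [IsFiniteMeasure m]
    (h : IsStationaryMean μ m) (hm : MeasurePreserving shift m m) {ν : Measure (ℤ → Y)}
    (hν : IsCodedMeasure f μ ν) {L : ℝ≥0∞} (hL0 : L ≠ 0) (hL : L ≠ ∞)
    (hint : ∫⁻ x, ((f (x 1)).length : ℝ≥0∞) ∂m ≠ ∞) (hrate : ∀ᵐ x ∂μ, rate f x = L)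
    {A : Set (ℤ → Y)} (hA : MeasurableSet A) :
    Tendsto (cesaro ν A) atTop (𝓝 (L⁻¹ * ∫⁻ x, G f A x ∂m)) := by
  have hG := measurable_G f hA
  have hGint : ∫⁻ x, G f A x ∂m ≠ ∞ :=
    ((lintegral_mono (G_le f A)).trans_lt hint.lt_top).ne
  set g : (ℤ → X) → ℝ≥0∞ := fun x => limsup (fun n => eAverage shift (G f A) n x) atTop with hg
  have hgm : Measurable g := .limsup fun n => measurable_eAverage measurable_shift hG n
  have hF : ∀ n : ℕ, Measurable fun x => (∑ i ∈ Finset.range n, F f A i x) / (n : ℝ≥0∞) :=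
    fun n => (Finset.measurable_sum _ fun i _ => measurable_F f hA i).div_const _
  have hces : ∀ n, cesaro ν A n = ∫⁻ x, (∑ i ∈ Finset.range n, F f A i x) / n ∂μ := fun n => by
    simp only [div_eq_mul_inv]
    rw [lintegral_mul_const _ (Finset.measurable_sum _ fun i _ => measurable_F f hA i),
      lintegral_finsetSum _ fun i _ => measurable_F f hA i, cesaro, div_eq_mul_inv]
    simp only [hν.measure_preimage_shift_iterate f hA]
  -- The averages of `G` and of the codeword length converge μ-almost surely; `birkhoffSum_G` reads
  -- the former as visits along the times S(x, n), and the time change applies.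
  have hlim : ∀ᵐ x ∂μ, Tendsto (fun n : ℕ => (∑ i ∈ Finset.range n, F f A i x) / (n : ℝ≥0∞)) atTop
      (𝓝 (g x / L)) := by
    filter_upwards [hrate,
      h.ae_tendsto_eAverage hm (measurable_length f) (fun _ => ENNReal.natCast_ne_top _) hint,
      h.ae_tendsto_eAverage hm hG (G_ne_top f A) hGint] with x hx h1 h2
    rw [← rate_eq, hx] at h1
    simp only [← S_div_eq_eAverage] at h1
    simp only [eAverage, birkhoffSum_G] at h2
    refine tendsto_eaverage_of_time_change (fun i => F_le_one f A i x) hL0 hL h1 ?_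
    simpa only [hg, eAverage, birkhoffSum_G] using h2
  have hdom := tendsto_lintegral_of_dominated_convergence (fun _ => 1) hF
    (fun n => .of_forall fun x => by
      refine ENNReal.div_le_of_le_mul ?_
      exact (Finset.sum_le_card_nsmul _ _ 1 fun k _ => F_le_one f A k x).trans (by simp))
    (by simp) hlim
  rw [funext hces]
  convert hdom using 2
  simp only [div_eq_mul_inv]
  rw [lintegral_mul_const _ hgm, h.lintegral_eq hgm (limsup_eAverage_comp (G_ne_top f A)),
    lintegral_limsup_eAverage hm hG (G_ne_top f A) hGint, mul_comm]

theorem lintegral_sizeBiased {Y : Type*} (f : X → List Y) (L : ℝ≥0∞)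
    (A : Set (ℤ → Y)) (hG : Measurable (G f A)) :
    ∫⁻ x, (∫⁻ k, F f A k x ∂(uniformOn (Set.Iio (f (x 1)).length))) ∂(sizeBiased f L m) =
      L⁻¹ * ∫⁻ x, G f A x ∂m := by
  simp only [lintegral_F_uniformOn]
  have hH : Measurable fun x : ℤ → X => ((f (x 1)).length : ℝ≥0∞)⁻¹ * G f A x :=
    (measurable_length f).inv.mul hG
  rw [sizeBiased, lintegral_withDensity_eq_lintegral_mul _ ((measurable_length f).div_const L) hH,
    ← lintegral_const_mul _ hG]
  refine lintegral_congr fun x => ?_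
  simp only [Pi.mul_apply]
  rcases Nat.eq_zero_or_pos (f (x 1)).length with h | h
  · simp [G, h]
  · rw [div_eq_mul_inv, mul_comm _ L⁻¹, mul_assoc, ← mul_assoc ((f (x 1)).length : ℝ≥0∞),
      ENNReal.mul_inv_cancel (by simpa using h.ne') (by simp), one_mul]

end CodedMeasure

end VLC

/-! ### The main theorem -/

theorem mainTheorem12 {X Y : Type*}
    [Countable X] [MeasurableSpace X] [DiscreteMeasurableSpace X]
    [Countable Y] [MeasurableSpace Y] [DiscreteMeasurableSpace Y]
    (f : X → List Y) (μ : Measure (ℤ → X)) [IsProbabilityMeasure μ] (hμ : VLC.IsAMS μ)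
    (hL₀ : 0 < VLC.expectedRate f μ) (hL : VLC.expectedRate f μ < ∞) :
    ∃ μbar : Measure (ℤ → X),
      -- the stationary mean of `μ`
      IsProbabilityMeasure μbar ∧ VLC.IsStationaryMean μ μbar ∧
      MeasurePreserving VLC.shift μbar μbar ∧
      -- the expansion rate and its expectation are well defined
      (∀ᵐ x ∂μ, Tendsto (fun n : ℕ => (VLC.S f x n : ℝ≥0∞) / n) atTop (𝓝 (VLC.rate f x))) ∧
      (∀ᵐ x ∂μbar, Tendsto (fun n : ℕ => (VLC.S f x n : ℝ≥0∞) / n) atTop (𝓝 (VLC.rate f x))) ∧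
      VLC.expectedRate f μ = VLC.expectedRate f μbar ∧
      VLC.expectedRate f μ = ∫⁻ x, ((f (x 1)).length : ℝ≥0∞) ∂μbar ∧
      -- the stationary measure `ρ`
      ∃ ρ : Measure (ℤ → Y), IsProbabilityMeasure ρ ∧ MeasurePreserving VLC.shift ρ ρ ∧
        (∀ A, MeasurableSet A →
          ρ A = (VLC.expectedRate f μ)⁻¹ * ∫⁻ x, VLC.G f A x ∂μbar) ∧
        -- `ρ` as an average over a random shift, uniform within the first codeword
        IsProbabilityMeasure (VLC.sizeBiased f (VLC.expectedRate f μ) μbar) ∧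
        (∀ A, MeasurableSet A →
          ρ A = ∫⁻ x, (∫⁻ k, VLC.F f A k x ∂(uniformOn (Set.Iio (f (x 1)).length)))
            ∂(VLC.sizeBiased f (VLC.expectedRate f μ) μbar)) ∧
        -- `ρ` is the stationary mean of `ν = μ ∘ (f^ℤ)⁻¹` if the expansion rate is constant
        ((∀ᵐ x ∂μ, VLC.rate f x = VLC.expectedRate f μ) →
          ∃ ν : Measure (ℤ → Y), IsProbabilityMeasure ν ∧ VLC.IsCodedMeasure f μ ν ∧
            VLC.IsAMS ν ∧ VLC.IsStationaryMean ν ρ) := by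
  set L := VLC.expectedRate f μ with hLdef
  -- `decode` needs a default letter; over an empty alphabet all codewords would be empty and L
  -- would be 0.
  have : Inhabited Y := by
    refine Classical.inhabited_of_nonempty ?_
    by_contra hY
    rw [not_nonempty_iff] at hY
    refine hL₀.ne' ?_
    have hf : ∀ a, f a = [] := fun a => List.eq_nil_of_length_eq_zero <| by
      by_contra hne
      exact hY.elim ((f a)[0]'(Nat.pos_of_ne_zero hne))
    simp [hLdef, VLC.expectedRate, VLC.rate, VLC.S, hf]
  obtain ⟨m, hprob, hmean⟩ := hμ.exists_isStationaryMean
  have hm := hmean.measurePreserving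
  have hLm : L = VLC.expectedRate f m :=
    hmean.lintegral_eq (VLC.measurable_rate f) (VLC.rate_shift f)
  have hlm := VLC.measurable_length (X := X) f
  have hlfin : ∀ x : ℤ → X, ((f (x 1)).length : ℝ≥0∞) ≠ ∞ := fun _ => ENNReal.natCast_ne_top _
  have hLrate : L = ∫⁻ x, limsup (fun n => VLC.eAverage VLC.shift
      (fun x => ((f (x 1)).length : ℝ≥0∞)) n x) atTop ∂m := by
    simp only [hLm, VLC.expectedRate, VLC.rate_eq]
  have hint : ∫⁻ x, ((f (x 1)).length : ℝ≥0∞) ∂m ≠ ∞ :=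
    ((VLC.lintegral_le_lintegral_limsup_eAverage hm hlm).trans_lt (hLrate ▸ hL)).ne
  have hLlen : L = ∫⁻ x, ((f (x 1)).length : ℝ≥0∞) ∂m :=
    hLrate.trans (VLC.lintegral_limsup_eAverage hm hlm hlfin hint)
  have hρ : ∀ A, MeasurableSet A → (L⁻¹ • VLC.blockMeasure f m : Measure (ℤ → Y)) A =
      L⁻¹ * ∫⁻ x, VLC.G f A x ∂m := fun A hA => by
    rw [Measure.smul_apply, VLC.blockMeasure_apply f hA, smul_eq_mul]
  refine ⟨m, hprob, hmean, hm, ?_, ?_, hLm, hLlen, L⁻¹ • VLC.blockMeasure f m, ⟨?_⟩, ?_, hρ, ⟨?_⟩,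
    fun A hA => ?_, fun hrate => ?_⟩
  · simpa only [VLC.S_div_eq_eAverage, VLC.rate_eq] using
      hmean.ae_tendsto_eAverage hm hlm hlfin hint
  · simpa only [VLC.S_div_eq_eAverage, VLC.rate_eq] using
      VLC.ae_tendsto_eAverage hm hlm hlfin hint
  · rw [Measure.smul_apply, VLC.blockMeasure_univ f hm, ← hLlen, smul_eq_mul,
      ENNReal.inv_mul_cancel hL₀.ne' hL.ne]
  · exact (VLC.measurePreserving_blockMeasure f hm).smul_measure _
  · rw [VLC.sizeBiased, withDensity_apply _ .univ, setLIntegral_univ]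
    simp only [div_eq_mul_inv]
    rw [lintegral_mul_const _ hlm, ← hLlen, ENNReal.mul_inv_cancel hL₀.ne' hL.ne]
  · rw [hρ A hA, VLC.lintegral_sizeBiased f L A (VLC.measurable_G f hA)]
  -- Positivity of the rate passes from μ to m, where recurrence makes almost every code two-sided;
  -- this invariant event passes back to μ, so the push-forward ν loses no mass.
  · have hpos : ∀ᵐ x ∂m, VLC.rate f x ≠ 0 := by
      have hms : MeasurableSet {x | VLC.rate f x ≠ 0} :=
        (measurableSet_eq_fun (VLC.measurable_rate f) measurable_const).compl
      rw [← hmean.ae_iff hms fun x => by rw [VLC.rate_shift]]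
      exact hrate.mono fun x hx => hx ▸ hL₀.ne'
    have hproper : ∀ᵐ x ∂μ, x ∈ VLC.properSet f :=
      (hmean.ae_iff (VLC.measurableSet_properSet f) fun x => VLC.shift_mem_properSet_iff f).2
        (VLC.ae_mem_properSet_of_rate_pos f hm hpos)
    have hcoded := VLC.isCodedMeasure_map_decode f hproper
    have hlim : VLC.IsStationaryMean (μ.map (VLC.decode f)) (L⁻¹ • VLC.blockMeasure f m) :=
      fun A hA => by
        rw [hρ A hA]
        exact VLC.tendsto_cesaro_codedMeasure f hmean hm hcoded hL₀.ne' hL.ne hint hrate hA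
    exact ⟨_, Measure.isProbabilityMeasure_map (VLC.measurable_decode f).aemeasurable, hcoded,
      fun A hA => ⟨_, hlim A hA⟩, hlim⟩
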